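/- For every sample size $n$ consider the MESS(1,1) model $$e^{\lambda_0 W}Y = X\beta_0+U,\qquad e^{\rho_0 M}U=V,$$ where $W=W_n$ and $M=M_n$ are $n\times n$ spatial weights matrices with zero diagonals, $X=X_n$ is a nonstochastic $n\times k$ matrix ($k$ fixed), $V=(v_{1},\dots,v_{n})'$ is the error vector, and $\zeta_0=(\lambda_0,\rho_0)$; put $\gamma_0=(\beta_0,\lambda_0,\rho_0)$. $W$ and $M$ need not commute. For $\zeta=(\lambda,\rho)$ let $V(\beta,\zeta)=e^{\rho M}(e^{\lambda W}Y-X\beta)$, $\mathbb W(\rho)=e^{\rho M}We^{-\rho M}$, $\mathbb W_D(\rho)=\mathbb W(\rho)-\mathrm{Diag}(\mathbb W(\rho))$, and consider the adjusted score functions $$\beta:\ X'e^{\rho M'}V(\beta,\zeta),\qquad \lambda:\ -Y'e^{\lambda W'}e^{\rho M'}\mathbb W_D(\rho)V(\beta,\zeta),\qquad \rho:\ -V(\beta,\zeta)'M\,V(\beta,\zeta).$$ The $\beta$-equation is solved by $\hat\beta_M(\zeta)=(X'e^{\rho M'}e^{\rho M}X)^{-1}X'e^{\rho M'}e^{\rho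 M}e^{\lambda W}Y$. Let $S^{c*}(\zeta)\in\mathbb R^2$ consist of the $\lambda$- and $\rho$-scores at $\beta=\hat\beta_M(\zeta)$, and let $\bar S^{c*}(\zeta)$ consist of the expectations of the $\lambda$- and $\rho$-scores at the nonrandom value $\beta=\bar\beta_M(\zeta)$, defined as $\hat\beta_M(\zeta)$ with $\mathrm E(Y)$ in place of $Y$. Assume: 1. For each $n$ the errors $v_i$ are independent with $\mathrm E(v_i)=0$ and possibly different variances $\sigma_i^2$, and for some $\varrho>0$ the moments $\mathrm E|v_i|^{4+\varrho}$ are bounded uniformly in $i$ and $n$. 2. $W$ and $M$ are bounded in row sum and column sum norms, uniformly in $n$. 3. The parameter space of $\zeta$ is $\Delta=[-c,c]\times[-c,c]$ with $c>0$, and $\zeta_0$ lies in the interior of $\Delta$. 4. The elements of $X$ are uniformly bounded, $X$ has full column rank for all large $n$, and $\lim_{n\to\infty}\frac1n X'e^{\rho M'}e^{\rho M}X$ exists and is nonsingular, uniformly in $\rho\in[-c,c]$ (that is, the convergence is uniform and the determinant of the limit is bounded away from $0$). 5. For every $\vartheta>0$, $\ \liminf_{n\to\infty}\ \inf_{\zeta\in\Delta:\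 d(\zeta,\zeta_0)\ge\vartheta}\ \frac1n\|\bar S^{c*}(\zeta)\|>0$. Let $\hat\zeta_M$ be an M-estimator, that is, any random element that with probability tending to one lies in $\Delta$ and satisfies $S^{c*}(\hat\zeta_M)=0$, and let $\hat\beta_M=\hat\beta_M(\hat\zeta_M)$. Then $\hat\gamma_M=(\hat\beta_M,\hat\zeta_M)\xrightarrow{\,p\,}\gamma_0$ as $n\to\infty$. -/

import Mathlib

open MeasureTheory ProbabilityTheory Filter Topology
open scoped Matrix

namespace MESS

noncomputable section

/-- The matrix exponential `e^{t A}`. -/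
def matExp {n : ℕ} (t : ℝ) (A : Matrix (Fin n) (Fin n) ℝ) : Matrix (Fin n) (Fin n) ℝ :=
  NormedSpace.exp (t • A)

/-- `𝕎(ρ) = e^{ρM} W e^{-ρM}`. -/
def WW {n : ℕ} (W M : Matrix (Fin n) (Fin n) ℝ) (rho : ℝ) : Matrix (Fin n) (Fin n) ℝ :=
  matExp rho M * W * matExp (-rho) M

/-- `𝕎_D(ρ) = 𝕎(ρ) - Diag(𝕎(ρ))`. -/
def WD {n : ℕ} (W M : Matrix (Fin n) (Fin n) ℝ) (rho : ℝ) : Matrix (Fin n) (Fin n) ℝ :=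
  WW W M rho - Matrix.diagonal (WW W M rho).diag

/-- `V(β, ζ) = e^{ρM} (e^{λW} y - X β)`, where `ζ = (λ, ρ)`. -/
def resid {n k : ℕ} (W M : Matrix (Fin n) (Fin n) ℝ) (X : Matrix (Fin n) (Fin k) ℝ)
    (y : Fin n → ℝ) (β : Fin k → ℝ) (ζ : ℝ × ℝ) : Fin n → ℝ :=
  matExp ζ.2 M *ᵥ (matExp ζ.1 W *ᵥ y - X *ᵥ β)

/-- The `β`-element of the adjusted score, `X' e^{ρM'} V(β, ζ)`. -/
def scoreBeta {n k : ℕ} (W M : Matrix (Fin n) (Fin n) ℝ) (X : Matrix (Fin n) (Fin k) ℝ)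
    (y : Fin n → ℝ) (β : Fin k → ℝ) (ζ : ℝ × ℝ) : Fin k → ℝ :=
  (Xᵀ * (matExp ζ.2 M)ᵀ) *ᵥ resid W M X y β ζ

/-- The `λ`-element of the adjusted score, `-y' e^{λW'} e^{ρM'} 𝕎_D(ρ) V(β, ζ)`. -/
def scoreLam {n k : ℕ} (W M : Matrix (Fin n) (Fin n) ℝ) (X : Matrix (Fin n) (Fin k) ℝ)
    (y : Fin n → ℝ) (β : Fin k → ℝ) (ζ : ℝ × ℝ) : ℝ :=
  -(y ⬝ᵥ (((matExp ζ.1 W)ᵀ * (matExp ζ.2 M)ᵀ * WD W M ζ.2) *ᵥ resid W M X y β ζ))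

/-- The `ρ`-element of the adjusted score, `-V(β, ζ)' M V(β, ζ)`. -/
def scoreRho {n k : ℕ} (W M : Matrix (Fin n) (Fin n) ℝ) (X : Matrix (Fin n) (Fin k) ℝ)
    (y : Fin n → ℝ) (β : Fin k → ℝ) (ζ : ℝ × ℝ) : ℝ :=
  -(resid W M X y β ζ ⬝ᵥ (M *ᵥ resid W M X y β ζ))

/-- The Gram matrix `X' e^{ρM'} e^{ρM} X`. -/
def gram {n k : ℕ} (M : Matrix (Fin n) (Fin n) ℝ) (X : Matrix (Fin n) (Fin k) ℝ) (rho : ℝ) :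
    Matrix (Fin k) (Fin k) ℝ :=
  Xᵀ * (matExp rho M)ᵀ * matExp rho M * X

/-- `(X' e^{ρM'} e^{ρM} X)⁻¹ X' e^{ρM'} e^{ρM} e^{λW} y`. For `y` the sample this is `β̂_M(ζ)`,
which solves `scoreBeta = 0` in `β`; for `y = E(Y)` it is its population counterpart `β̄_M(ζ)`. -/
def betaOf {n k : ℕ} (W M : Matrix (Fin n) (Fin n) ℝ) (X : Matrix (Fin n) (Fin k) ℝ)
    (y : Fin n → ℝ) (ζ : ℝ × ℝ) : Fin k → ℝ :=
  ((gram M X ζ.2)⁻¹ * Xᵀ * (matExp ζ.2 M)ᵀ * matExp ζ.2 M * matExp ζ.1 W) *ᵥ y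

/-- The concentrated adjusted score `S^{c*}(ζ)`: the `λ`- and `ρ`-elements of the adjusted score
at `β = β̂_M(ζ)`. -/
def concScore {n k : ℕ} (W M : Matrix (Fin n) (Fin n) ℝ) (X : Matrix (Fin n) (Fin k) ℝ)
    (y : Fin n → ℝ) (ζ : ℝ × ℝ) : ℝ × ℝ :=
  (scoreLam W M X y (betaOf W M X y ζ) ζ, scoreRho W M X y (betaOf W M X y ζ) ζ)

/-- The population counterpart `S̄^{c*}(ζ)`: the expectations of the `λ`- and `ρ`-elements of the
adjusted score at `β = β̄_M(ζ)`, the latter being computed from `E(Y)`. -/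
def popConcScore {Ω : Type*} [MeasurableSpace Ω] (μ : Measure Ω) {n k : ℕ}
    (W M : Matrix (Fin n) (Fin n) ℝ) (X : Matrix (Fin n) (Fin k) ℝ)
    (Y : Ω → Fin n → ℝ) (ζ : ℝ × ℝ) : ℝ × ℝ :=
  let βbar : Fin k → ℝ := betaOf W M X (fun i => ∫ ω, Y ω i ∂μ) ζ
  (∫ ω, scoreLam W M X (Y ω) βbar ζ ∂μ, ∫ ω, scoreRho W M X (Y ω) βbar ζ ∂μ)

/-- The compact parameter space `Δ = [-c, c] × [-c, c]`. -/
def paramSpace (c : ℝ) : Set (ℝ × ℝ) := Set.Icc (-c) c ×ˢ Set.Icc (-c) c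

/-- The MESS(1,1) model `e^{λ₀W} Y = X β₀ + U`, `e^{ρ₀M} U = V`, for every sample size `n`, with
spatial weights matrices that have zero diagonals. -/
structure Model {Ω : Type*} {k : ℕ} (W M : ∀ n : ℕ, Matrix (Fin n) (Fin n) ℝ)
    (X : ∀ n : ℕ, Matrix (Fin n) (Fin k) ℝ) (β₀ : Fin k → ℝ) (ζ₀ : ℝ × ℝ)
    (Y U V : ∀ n : ℕ, Ω → Fin n → ℝ) : Prop where
  diag_W : ∀ n i, W n i i = 0
  diag_M : ∀ n i, M n i i = 0
  outcome : ∀ n ω, matExp ζ₀.1 (W n) *ᵥ Y n ω = X n *ᵥ β₀ + U n ω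
  disturbance : ∀ n ω, matExp ζ₀.2 (M n) *ᵥ U n ω = V n ω

/-- Independent, heteroskedastic errors with mean zero and a moment of order above four that is
bounded uniformly over units and sample sizes. The variances are otherwise unrestricted. -/
structure HeteroskedasticErrors {Ω : Type*} [MeasurableSpace Ω] (μ : Measure Ω)
    (V : ∀ n : ℕ, Ω → Fin n → ℝ) : Prop where
  measurable : ∀ n i, Measurable (fun ω => V n ω i)
  indep : ∀ n, iIndepFun (fun (i : Fin n) ω => V n ω i) μ
  mean_zero : ∀ n i, ∫ ω, V n ω i ∂μ = 0
  moment : ∃ ϱ : ℝ, 0 < ϱ ∧ ∃ C : ℝ, ∀ n i,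
    Integrable (fun ω => |V n ω i| ^ (4 + ϱ)) μ ∧ ∫ ω, |V n ω i| ^ (4 + ϱ) ∂μ ≤ C

/-- Uniform boundedness of a sequence of square matrices in the row sum and the column sum norm. -/
def BoundedSums (A : ∀ n : ℕ, Matrix (Fin n) (Fin n) ℝ) : Prop :=
  ∃ K : ℝ, (∀ n i, ∑ j, |A n i j| ≤ K) ∧ (∀ n j, ∑ i, |A n i j| ≤ K)

/-- Regularity of the nonstochastic regressors: uniformly bounded elements, full column rank (in
large samples, since it needs `n ≥ k`), and `lim (1/n) X' e^{ρM'} e^{ρM} X` exists and is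
nonsingular, uniformly in `ρ ∈ [-c, c]`. -/
structure RegularRegressors {k : ℕ} (M : ∀ n : ℕ, Matrix (Fin n) (Fin n) ℝ)
    (X : ∀ n : ℕ, Matrix (Fin n) (Fin k) ℝ) (c : ℝ) : Prop where
  bounded : ∃ C : ℝ, ∀ n i j, |X n i j| ≤ C
  full_rank : ∀ᶠ n in atTop, (X n).rank = k
  limit : ∃ L : ℝ → Matrix (Fin k) (Fin k) ℝ,
    TendstoUniformlyOn (fun (n : ℕ) rho => (n : ℝ)⁻¹ • gram (M n) (X n) rho) L atTop
      (Set.Icc (-c) c) ∧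
    ∃ δ : ℝ, 0 < δ ∧ ∀ rho ∈ Set.Icc (-c) c, δ ≤ |(L rho).det|

/-- Identification: for every `ϑ > 0`,
`liminf_n inf {(1/n) ‖S̄^{c*}(ζ)‖ : ζ ∈ Δ, d(ζ, ζ₀) ≥ ϑ} > 0`. Distance and norm are those of the
product `ℝ × ℝ`; the condition is the same for any other norms on the plane. -/
def Identified {Ω : Type*} [MeasurableSpace Ω] (μ : Measure Ω) {k : ℕ}
    (W M : ∀ n : ℕ, Matrix (Fin n) (Fin n) ℝ) (X : ∀ n : ℕ, Matrix (Fin n) (Fin k) ℝ)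
    (Y : ∀ n : ℕ, Ω → Fin n → ℝ) (ζ₀ : ℝ × ℝ) (c : ℝ) : Prop :=
  ∀ ϑ : ℝ, 0 < ϑ → ∃ δ : ℝ, 0 < δ ∧ ∀ᶠ n : ℕ in atTop, ∀ ζ ∈ paramSpace c,
    ϑ ≤ dist ζ ζ₀ → δ ≤ (n : ℝ)⁻¹ * ‖popConcScore μ (W n) (M n) (X n) (Y n) ζ‖

/-- `ζ̂` is an M-estimator of `ζ₀`: with probability tending to one it lies in the parameter space
and is a root of the concentrated adjusted score. Any choice of a root is allowed, and (outer
measure) no measurability of the choice is required. -/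
def IsMEstimator {Ω : Type*} [MeasurableSpace Ω] (μ : Measure Ω) {k : ℕ}
    (W M : ∀ n : ℕ, Matrix (Fin n) (Fin n) ℝ) (X : ∀ n : ℕ, Matrix (Fin n) (Fin k) ℝ)
    (Y : ∀ n : ℕ, Ω → Fin n → ℝ) (c : ℝ) (ζhat : ℕ → Ω → ℝ × ℝ) : Prop :=
  Tendsto (fun n => μ {ω | ¬ (ζhat n ω ∈ paramSpace c ∧
    concScore (W n) (M n) (X n) (Y n ω) (ζhat n ω) = 0)}) atTop (𝓝 0)

end

end MESS

/-! By the model, `e^{λW} Y = e^{(λ-λ₀)W} (X β₀ + e^{-ρ₀M} V)`, so every residual, divided by `√n`,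
is affine in the scaled error vector: `a + B V/√n`. Here `a` and the spectral norm of `B` are
bounded and Lipschitz in the parameters, with constants free of `n`. The vector `e^{ρM} e^{λW} Y` in
the `λ`-score is itself the residual at `β = 0`. Hence both scores, divided by `-n`, are inner
products of two such affine vectors (`scoreLam_eq`, `scoreRho_eq`). Commutation of `W` and `M` never
enters.

Such an inner product is a quadratic polynomial in independent errors with bounded fourth moments,
and its variance is `O(1/n)` (`integral_inner_affineVec_centered_sq_le`). Its paths are Lipschitz
with constant a multiple of `1 + ‖V‖²/n`, which is bounded in mean, so Chebyshev on a finite net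
gives a law of large numbers uniform over compact parameter sets (`uniform_lln_inner_affineVec`).

The difference between `β̂(ζ)` and `β̄(ζ)` is a bounded inverse Gram matrix times terms linear in
the errors, hence uniformly small in probability. At a root `ζ̂` the sample scores vanish at `β̂`.
By the Lipschitz bound in `β` they are small at `β̄`, by the law of large numbers so are their
means, and identification forces `ζ̂` near `ζ₀`. Finally `β̄(λ₀, ρ) = β₀` for every `ρ`, so `‖β̄(ζ)
- β₀‖ ≤ C d(ζ, ζ₀)` (`exists_betaOf_bounds`), and `β̂` converges too. -/

namespace MESS

/-! ### Moments of linear and quadratic forms in independent errors. -/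

section Moments

variable {Ω : Type*} [MeasurableSpace Ω] {μ : Measure Ω}
  {ι : Type*} {v : ι → Ω → ℝ}

theorem abs_mul_four_le (a b c d : ℝ) : |a * (b * (c * d))| ≤ a ^ 4 + b ^ 4 + c ^ 4 + d ^ 4 := by
  have h1 : |a * b| ≤ a ^ 2 + b ^ 2 := by
    rw [abs_le]; constructor <;> nlinarith [sq_nonneg (a + b), sq_nonneg (a - b)]
  have h2 : |c * d| ≤ c ^ 2 + d ^ 2 := by
    rw [abs_le]; constructor <;> nlinarith [sq_nonneg (c + d), sq_nonneg (c - d)]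
  have h3 : |a * (b * (c * d))| = |a * b| * |c * d| := by rw [← abs_mul]; ring_nf
  rw [h3]
  have h4 := mul_le_mul h1 h2 (abs_nonneg _) (by positivity)
  nlinarith [sq_nonneg (a ^ 2 - c ^ 2), sq_nonneg (a ^ 2 - d ^ 2), sq_nonneg (b ^ 2 - c ^ 2),
    sq_nonneg (b ^ 2 - d ^ 2)]

theorem integrable_mul_four (hm : ∀ i, Measurable (v i))
    (h4 : ∀ i, Integrable (fun ω => v i ω ^ 4) μ) (i j k l : ι) :
    Integrable (fun ω => v i ω * (v j ω * (v k ω * v l ω))) μ := by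
  have := hm i; have := hm j; have := hm k; have := hm l
  refine Integrable.mono' ((((h4 i).add (h4 j)).add (h4 k)).add (h4 l))
    (by fun_prop) (Eventually.of_forall fun ω => ?_)
  exact abs_mul_four_le _ _ _ _

theorem integrable_mul_two [IsFiniteMeasure μ] (hm : ∀ i, Measurable (v i))
    (h4 : ∀ i, Integrable (fun ω => v i ω ^ 4) μ) (i j : ι) :
    Integrable (fun ω => v i ω * v j ω) μ := by
  have := hm i; have := hm j
  refine Integrable.mono' (((h4 i).add (h4 j)).add (integrable_const 2))
    (by fun_prop) (Eventually.of_forall fun ω => ?_)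
  have := abs_mul_four_le (v i ω) (v j ω) 1 1
  simp only [mul_one] at this
  simp only [Real.norm_eq_abs, Pi.add_apply]
  linarith

theorem integrable_of_pow_four [IsFiniteMeasure μ] (hm : ∀ i, Measurable (v i))
    (h4 : ∀ i, Integrable (fun ω => v i ω ^ 4) μ) (i : ι) : Integrable (v i) μ := by
  have := hm i
  refine Integrable.mono' ((h4 i).add (integrable_const 3))
    (by fun_prop) (Eventually.of_forall fun ω => ?_)
  have := abs_mul_four_le (v i ω) 1 1 1
  simp only [mul_one] at this
  simp only [Real.norm_eq_abs, Pi.add_apply]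
  linarith

/-- Independence splits off the centred factor. The function `g` is arbitrary so that the remaining
indices may coincide. -/
theorem integral_mul_of_notMem [Fintype ι] [DecidableEq ι] (hm : ∀ i, Measurable (v i))
    (hind : iIndepFun v μ) (h0 : ∀ i, ∫ ω, v i ω ∂μ = 0) (i : ι) (T : Finset ι) (hi : i ∉ T)
    (g : (T → ℝ) → ℝ) (hg : Measurable g) :
    ∫ ω, v i ω * g (fun j => v j ω) ∂μ = 0 := by
  have h := hind.indepFun_finset {i} T (by simpa using hi) hm
  have hφ : Measurable (fun x : ({i} : Finset ι) → ℝ => x ⟨i, by simp⟩) := measurable_pi_apply _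
  have h' := h.comp hφ hg
  have e := h'.integral_mul_eq_mul_integral
    (by have := hm i; exact Measurable.aestronglyMeasurable (by fun_prop))
    (by exact (hg.comp (measurable_pi_lambda _ fun j => hm j)).aestronglyMeasurable)
  simp only [Function.comp_def, Pi.mul_apply] at e
  simpa [h0] using e

theorem integral_mul_two_of_ne [Fintype ι] [DecidableEq ι] (hm : ∀ i, Measurable (v i))
    (hind : iIndepFun v μ) (h0 : ∀ i, ∫ ω, v i ω ∂μ = 0) {i j : ι} (h : i ≠ j) :
    ∫ ω, v i ω * v j ω ∂μ = 0 :=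
  integral_mul_of_notMem hm hind h0 i {j} (by simpa using h) (fun x => x ⟨j, by simp⟩)
    (by fun_prop)

theorem integral_mul_four_of_notMem [Fintype ι] [DecidableEq ι] (hm : ∀ i, Measurable (v i))
    (hind : iIndepFun v μ) (h0 : ∀ i, ∫ ω, v i ω ∂μ = 0) {i j k l : ι}
    (hj : i ≠ j) (hk : i ≠ k) (hl : i ≠ l) :
    ∫ ω, v i ω * (v j ω * (v k ω * v l ω)) ∂μ = 0 :=
  integral_mul_of_notMem hm hind h0 i {j, k, l} (by simp [*])
    (fun x => x ⟨j, by simp⟩ * (x ⟨k, by simp⟩ * x ⟨l, by simp⟩)) (by fun_prop)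

/-- The fourth mixed moments of independent centred variables factorize, unless the two pairs of
indices agree up to order. -/
theorem integral_mul_four_eq [Fintype ι] [DecidableEq ι] (hm : ∀ i, Measurable (v i))
    (hind : iIndepFun v μ) (h0 : ∀ i, ∫ ω, v i ω ∂μ = 0) {i j k l : ι}
    (h1 : ¬ (i = k ∧ j = l)) (h2 : ¬ (i = l ∧ j = k)) :
    ∫ ω, v i ω * (v j ω * (v k ω * v l ω)) ∂μ =
      (∫ ω, v i ω * v j ω ∂μ) * ∫ ω, v k ω * v l ω ∂μ := by
  -- Either both pairs are diagonal and distinct, and the two squares are independent, or some index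
  -- occurs exactly once, and both sides vanish.
  by_cases hij : i = j
  · subst hij
    by_cases hkl : k = l
    · subst hkl
      have hik : i ≠ k := fun h => h1 ⟨h, h⟩
      have h := (hind.indepFun hik).comp (φ := fun x => x * x) (ψ := fun x => x * x)
        (by fun_prop) (by fun_prop)
      have e := h.integral_mul_eq_mul_integral
        (by have := hm i; exact Measurable.aestronglyMeasurable (by fun_prop))
        (by have := hm k; exact Measurable.aestronglyMeasurable (by fun_prop))
      simp only [Function.comp_def, Pi.mul_apply] at e
      rw [← e]
      congr 1; ext ω; ring
    · rw [integral_mul_two_of_ne hm hind h0 hkl, mul_zero]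
      by_cases hik : i = k
      · have hil : i ≠ l := fun h => hkl (hik.symm.trans h)
        rw [← integral_mul_four_of_notMem hm hind h0 (i := l) (j := i) (k := i) (l := k)
          hil.symm hil.symm (Ne.symm hkl)]
        congr 1; ext ω; ring
      · rw [← integral_mul_four_of_notMem hm hind h0 (i := k) (j := i) (k := i) (l := l)
          (Ne.symm hik) (Ne.symm hik) hkl]
        congr 1; ext ω; ring
  · rw [integral_mul_two_of_ne hm hind h0 hij, zero_mul]
    by_cases hik : i = k
    · have hjl : j ≠ l := fun h => h1 ⟨hik, h⟩
      have hjk : j ≠ k := fun h => hij (hik.trans h.symm)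
      rw [← integral_mul_four_of_notMem hm hind h0 (i := j) (j := i) (k := k) (l := l)
          (Ne.symm hij) hjk hjl]
      congr 1; ext ω; ring
    · by_cases hil : i = l
      · have hjk : j ≠ k := fun h => h2 ⟨hil, h⟩
        have hjl : j ≠ l := fun h => hij (hil.trans h.symm)
        rw [← integral_mul_four_of_notMem hm hind h0 (i := j) (j := i) (k := k) (l := l)
            (Ne.symm hij) hjk hjl]
        congr 1; ext ω; ring
      · exact integral_mul_four_of_notMem hm hind h0 hij hik hil

theorem integral_mul_self_le [IsProbabilityMeasure μ] (hm : ∀ i, Measurable (v i))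
    (h4 : ∀ i, Integrable (fun ω => v i ω ^ 4) μ) {C : ℝ} (hC : ∀ i, ∫ ω, v i ω ^ 4 ∂μ ≤ C)
    (i : ι) : ∫ ω, v i ω * v i ω ∂μ ≤ 1 + C := by
  calc ∫ ω, v i ω * v i ω ∂μ ≤ ∫ ω, (1 + v i ω ^ 4) ∂μ := by
        refine integral_mono (integrable_mul_two hm h4 i i) ((integrable_const _).add (h4 i))
          fun ω => ?_
        change v i ω * v i ω ≤ 1 + v i ω ^ 4
        nlinarith [sq_nonneg (v i ω ^ 2 - 1)]
    _ = 1 + ∫ ω, v i ω ^ 4 ∂μ := by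
        rw [integral_add (integrable_const _) (h4 i)]; simp
    _ ≤ 1 + C := by linarith [hC i]

theorem integral_linear_sq_le [IsProbabilityMeasure μ] [Fintype ι] [DecidableEq ι] (hm : ∀ i, Measurable (v i))
    (hind : iIndepFun v μ) (h0 : ∀ i, ∫ ω, v i ω ∂μ = 0)
    (h4 : ∀ i, Integrable (fun ω => v i ω ^ 4) μ) {C : ℝ} (hC : ∀ i, ∫ ω, v i ω ^ 4 ∂μ ≤ C)
    (a : ι → ℝ) :
    Integrable (fun ω => (∑ i, a i * v i ω) ^ 2) μ ∧
      ∫ ω, (∑ i, a i * v i ω) ^ 2 ∂μ ≤ (1 + C) * ∑ i, a i ^ 2 := by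
  have hint : ∀ i j, Integrable (fun ω => a i * a j * (v i ω * v j ω)) μ := fun i j =>
    (integrable_mul_two hm h4 i j).const_mul _
  have e : ∀ ω, (∑ i, a i * v i ω) ^ 2 = ∑ i, ∑ j, a i * a j * (v i ω * v j ω) := fun ω => by
    rw [sq, Finset.sum_mul_sum]
    exact Finset.sum_congr rfl fun i _ => Finset.sum_congr rfl fun j _ => by ring
  simp_rw [e]
  refine ⟨integrable_finsetSum _ fun i _ => integrable_finsetSum _ fun j _ => hint i j, ?_⟩
  rw [integral_finsetSum _ fun i _ => integrable_finsetSum _ fun j _ => hint i j, Finset.mul_sum]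
  refine Finset.sum_le_sum fun i _ => ?_
  rw [integral_finsetSum _ fun j _ => hint i j, Finset.sum_eq_single i]
  · rw [integral_const_mul]
    nlinarith [integral_mul_self_le hm h4 hC i, sq_nonneg (a i)]
  · intro j _ hj
    rw [integral_const_mul, integral_mul_two_of_ne hm hind h0 (Ne.symm hj), mul_zero]
  · simp

/-- The centred products indexed by two pairs are uncorrelated unless the pairs agree up to order.
Thus at most two terms per pair survive, each with second moment at most `4 * C`. -/
theorem integral_quadratic_centered_sq_le [IsProbabilityMeasure μ] [Fintype ι] [DecidableEq ι] (hm : ∀ i, Measurable (v i))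
    (hind : iIndepFun v μ) (h0 : ∀ i, ∫ ω, v i ω ∂μ = 0)
    (h4 : ∀ i, Integrable (fun ω => v i ω ^ 4) μ) {C : ℝ} (hC : ∀ i, ∫ ω, v i ω ^ 4 ∂μ ≤ C)
    (A : ι → ι → ℝ) :
    Integrable
        (fun ω => (∑ i, ∑ j, A i j * (v i ω * v j ω - ∫ ω', v i ω' * v j ω' ∂μ)) ^ 2) μ ∧
      ∫ ω, (∑ i, ∑ j, A i j * (v i ω * v j ω - ∫ ω', v i ω' * v j ω' ∂μ)) ^ 2 ∂μ ≤
        8 * C * ∑ i, ∑ j, A i j ^ 2 := by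
  set m : ι → ι → ℝ := fun i j => ∫ ω, v i ω * v j ω ∂μ with hmdef
  set D : ι × ι → Ω → ℝ := fun p ω => v p.1 ω * v p.2 ω - m p.1 p.2 with hD
  have i4 := integrable_mul_four hm h4
  have i2 := integrable_mul_two hm h4
  have eD : ∀ p q ω, D p ω * D q ω = v p.1 ω * (v p.2 ω * (v q.1 ω * v q.2 ω))
      - m q.1 q.2 * (v p.1 ω * v p.2 ω) - m p.1 p.2 * (v q.1 ω * v q.2 ω)
      + m p.1 p.2 * m q.1 q.2 := fun p q ω => by simp only [hD]; ring
  have hDint : ∀ p q, Integrable (fun ω => D p ω * D q ω) μ := fun p q => by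
    simp_rw [eD]
    exact (((i4 _ _ _ _).sub ((i2 _ _).const_mul _)).sub ((i2 _ _).const_mul _)).add
      (integrable_const _)
  have eI : ∀ p q, ∫ ω, D p ω * D q ω ∂μ =
      ∫ ω, v p.1 ω * (v p.2 ω * (v q.1 ω * v q.2 ω)) ∂μ - m p.1 p.2 * m q.1 q.2 := fun p q => by
    simp_rw [eD]
    have j1 := (i2 p.1 p.2).const_mul (m q.1 q.2)
    have j2 := (i2 q.1 q.2).const_mul (m p.1 p.2)
    have j3 : Integrable (fun ω => v p.1 ω * (v p.2 ω * (v q.1 ω * v q.2 ω))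
      - m q.1 q.2 * (v p.1 ω * v p.2 ω)) μ := (i4 _ _ _ _).sub j1
    have j4 : Integrable (fun ω => v p.1 ω * (v p.2 ω * (v q.1 ω * v q.2 ω))
      - m q.1 q.2 * (v p.1 ω * v p.2 ω) - m p.1 p.2 * (v q.1 ω * v q.2 ω)) μ := j3.sub j2
    rw [integral_add j4 (integrable_const _), integral_sub j3 j2, integral_sub (i4 _ _ _ _) j1,
      integral_const_mul, integral_const_mul]
    simp only [integral_const, probReal_univ, smul_eq_mul, one_mul, hmdef]
    ring
  have hself : ∀ p, ∫ ω, D p ω * D p ω ∂μ ≤ 4 * C := fun p => by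
    rw [eI]
    have : ∫ ω, v p.1 ω * (v p.2 ω * (v p.1 ω * v p.2 ω)) ∂μ ≤
        ∫ ω, (2 * v p.1 ω ^ 4 + 2 * v p.2 ω ^ 4) ∂μ :=
      integral_mono (i4 _ _ _ _) (((h4 _).const_mul 2).add ((h4 _).const_mul 2))
        fun ω => ((le_abs_self _).trans (abs_mul_four_le _ _ _ _)).trans
          (le_of_eq (by ring))
    rw [integral_add ((h4 _).const_mul 2) ((h4 _).const_mul 2), integral_const_mul,
      integral_const_mul] at this
    have := hC p.1; have := hC p.2
    nlinarith [mul_self_nonneg (m p.1 p.2)]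
  have hswap : ∀ p : ι × ι, D p.swap = D p := fun p => by
    ext ω; simp only [hD, hmdef, Prod.fst_swap, Prod.snd_swap, mul_comm]
  have hzero : ∀ p q : ι × ι, q ≠ p → q ≠ p.swap → ∫ ω, D p ω * D q ω ∂μ = 0 := by
    intro p q h1 h2
    rw [eI, integral_mul_four_eq hm hind h0, sub_self]
    · exact fun h => h1 (Prod.ext h.1.symm h.2.symm)
    · exact fun h => h2 (Prod.ext h.2.symm h.1.symm)
  have e : ∀ ω, (∑ i, ∑ j, A i j * (v i ω * v j ω - m i j)) ^ 2 =
      ∑ p : ι × ι, ∑ q : ι × ι, A p.1 p.2 * A q.1 q.2 * (D p ω * D q ω) := fun ω => by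
    rw [← Fintype.sum_prod_type' (f := fun i j => A i j * (v i ω * v j ω - m i j)), sq,
      Finset.sum_mul_sum]
    exact Finset.sum_congr rfl fun i _ => Finset.sum_congr rfl fun j _ => by
      simp only [hD]; ring
  have hint : ∀ p q : ι × ι, Integrable
      (fun ω => A p.1 p.2 * A q.1 q.2 * (D p ω * D q ω)) μ := fun p q => (hDint p q).const_mul _
  have hC0 : ∀ p : ι × ι, 0 ≤ ∫ ω, D p ω * D p ω ∂μ := fun p =>
    integral_nonneg fun ω => mul_self_nonneg _
  change Integrable (fun ω => (∑ i, ∑ j, A i j * (v i ω * v j ω - m i j)) ^ 2) μ ∧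
    ∫ ω, (∑ i, ∑ j, A i j * (v i ω * v j ω - m i j)) ^ 2 ∂μ ≤ _
  simp_rw [e]
  refine ⟨integrable_finsetSum _ fun i _ => integrable_finsetSum _ fun j _ => hint i j, ?_⟩
  rw [integral_finsetSum _ fun i _ => integrable_finsetSum _ fun j _ => hint i j]
  -- The term `q = p` gives `4 * C` times the square of the entry; the cross term with the
  -- transposed entry is split by `xy ≤ (x² + y²)/2`, adding `2 * C` to each square. Summation over
  -- `p` gives the constant `8 * C`.
  have key : ∀ p : ι × ι, ∫ ω, ∑ q : ι × ι, A p.1 p.2 * A q.1 q.2 * (D p ω * D q ω) ∂μ ≤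
      6 * C * A p.1 p.2 ^ 2 + 2 * C * A p.swap.1 p.swap.2 ^ 2 := fun p => by
    rw [integral_finsetSum _ fun j _ => hint p j]
    simp_rw [integral_const_mul]
    have hp := hself p
    have hp0 := hC0 p
    by_cases hs : p.swap = p
    · rw [Finset.sum_eq_single p (fun q _ hq => by
        rw [hzero p q hq (by rw [hs]; exact hq), mul_zero]) (by simp), hs]
      nlinarith [sq_nonneg (A p.1 p.2)]
    · rw [← Finset.sum_subset (Finset.subset_univ {p, p.swap}) (fun q _ hq => by
        simp only [Finset.mem_insert, Finset.mem_singleton, not_or] at hq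
        rw [hzero p q hq.1 hq.2, mul_zero]), Finset.sum_pair (Ne.symm hs), hswap]
      set I := ∫ ω, D p ω * D p ω ∂μ
      have h3 : A p.1 p.2 * A p.swap.1 p.swap.2 ≤
        (A p.1 p.2 ^ 2 + A p.swap.1 p.swap.2 ^ 2) / 2 := by
          nlinarith [sq_nonneg (A p.1 p.2 - A p.swap.1 p.swap.2)]
      have h4 := mul_le_mul_of_nonneg_right h3 hp0
      have h5 := mul_le_mul_of_nonneg_left hp (sq_nonneg (A p.1 p.2))
      have h6 := mul_le_mul_of_nonneg_left hp (sq_nonneg (A p.swap.1 p.swap.2))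
      nlinarith
  refine (Finset.sum_le_sum fun p _ => key p).trans (le_of_eq ?_)
  rw [Finset.sum_add_distrib, ← Finset.mul_sum, ← Finset.mul_sum,
    show ∑ p : ι × ι, A p.swap.1 p.swap.2 ^ 2 = ∑ p : ι × ι, A p.1 p.2 ^ 2 from
      Equiv.sum_comp (Equiv.prodComm ι ι) (fun p : ι × ι => A p.1 p.2 ^ 2), Fintype.sum_prod_type]
  ring

end Moments

/-! ### Spectral norms of matrices and of matrix exponentials. -/

section Norms

open scoped Matrix.Norms.L2Operator

variable {n : ℕ}

theorem l2_norm_transpose (A : Matrix (Fin n) (Fin n) ℝ) : ‖Aᵀ‖ = ‖A‖ := by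
  rw [← Matrix.conjTranspose_eq_transpose_of_trivial, Matrix.l2_opNorm_conjTranspose]

/-- Only an inequality, since the norm is `0` when `n = 0`. -/
theorem l2_norm_one_le : ‖(1 : Matrix (Fin n) (Fin n) ℝ)‖ ≤ 1 := by
  rw [← Matrix.diagonal_one, Matrix.l2_opNorm_diagonal]
  exact (pi_norm_le_iff_of_nonneg zero_le_one).2 fun _ => by simp

theorem l2_norm_mulVec_le (A : Matrix (Fin n) (Fin n) ℝ) (x : Fin n → ℝ) :
    ‖WithLp.toLp 2 (A *ᵥ x)‖ ≤ ‖A‖ * ‖WithLp.toLp 2 x‖ :=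
  Matrix.l2_opNorm_mulVec A (WithLp.toLp 2 x)

theorem abs_apply_le_l2_norm (A : Matrix (Fin n) (Fin n) ℝ) (i j : Fin n) : |A i j| ≤ ‖A‖ := by
  have h := l2_norm_mulVec_le A (Pi.single j 1)
  have h2 := PiLp.norm_apply_le (WithLp.toLp 2 (A *ᵥ Pi.single j 1)) i
  simp at h h2
  exact h2.trans h

/-- Each column is the image of a unit vector. This bound is the source of the `1/n` rate for the
quadratic part of the variance. -/
theorem sum_sq_le_l2_norm (A : Matrix (Fin n) (Fin n) ℝ) :
    ∑ i, ∑ j, A i j ^ 2 ≤ n * ‖A‖ ^ 2 := by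
  rw [Finset.sum_comm]
  calc ∑ j, ∑ i, A i j ^ 2 ≤ ∑ j : Fin n, ‖A‖ ^ 2 := by
        refine Finset.sum_le_sum fun j _ => ?_
        have h := l2_norm_mulVec_le A (Pi.single j 1)
        have h2 := EuclideanSpace.real_norm_sq_eq (WithLp.toLp 2 (A *ᵥ Pi.single j 1))
        simp at h h2
        rw [← h2]
        gcongr
    _ = n * ‖A‖ ^ 2 := by simp

theorem l2_norm_diagonal_diag_le (A : Matrix (Fin n) (Fin n) ℝ) :
    ‖Matrix.diagonal A.diag‖ ≤ ‖A‖ := by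
  rw [Matrix.l2_opNorm_diagonal]
  exact (pi_norm_le_iff_of_nonneg (norm_nonneg _)).2 fun i => abs_apply_le_l2_norm A i i

/-- Schur's test: row and column sums bound the spectral norm. -/
theorem l2_norm_le_of_sums (A : Matrix (Fin n) (Fin n) ℝ) {K : ℝ} (hK : 0 ≤ K)
    (hr : ∀ i, ∑ j, |A i j| ≤ K) (hc : ∀ j, ∑ i, |A i j| ≤ K) : ‖A‖ ≤ K := by
  rw [Matrix.l2_opNorm_def]
  refine ContinuousLinearMap.opNorm_le_bound _ hK fun x => ?_
  refine le_of_sq_le_sq ?_ (by positivity)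
  rw [mul_pow, EuclideanSpace.real_norm_sq_eq, EuclideanSpace.real_norm_sq_eq]
  have e : ∀ i, ((Matrix.toEuclideanLin A).toContinuousLinearMap x) i = ∑ j, A i j * x j :=
    fun i => rfl
  calc ∑ i, (∑ j, A i j * x j) ^ 2 ≤ ∑ i, K * ∑ j, |A i j| * x j ^ 2 := by
        refine Finset.sum_le_sum fun i _ => ?_
        -- Cauchy–Schwarz with weights `|A i j|`: the row sums are used here, the column sums after
        -- exchanging the summations.
        calc (∑ j, A i j * x j) ^ 2 ≤ (∑ j, |A i j|) * ∑ j, |A i j| * x j ^ 2 := by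
              refine Finset.sum_sq_le_sum_mul_sum_of_sq_le_mul _ (fun j _ => abs_nonneg _)
                (fun j _ => by positivity) fun j _ => ?_
              rw [mul_pow, ← sq_abs (A i j)]; exact le_of_eq (by ring)
          _ ≤ K * ∑ j, |A i j| * x j ^ 2 :=
              mul_le_mul_of_nonneg_right (hr i) (Finset.sum_nonneg fun j _ => by positivity)
    _ = K * ∑ j, (∑ i, |A i j|) * x j ^ 2 := by
        rw [← Finset.mul_sum, Finset.sum_comm]
        simp_rw [Finset.sum_mul]
    _ ≤ K * ∑ j, K * x j ^ 2 := by
        gcongr with j; exact hc j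
    _ = K ^ 2 * ∑ j, x j ^ 2 := by rw [← Finset.mul_sum]; ring

theorem l2_norm_pow_le (A : Matrix (Fin n) (Fin n) ℝ) (m : ℕ) : ‖A ^ m‖ ≤ ‖A‖ ^ m := by
  cases m with
  | zero => simpa using l2_norm_one_le
  | succ m => exact norm_pow_le' A m.succ_pos

theorem l2_norm_exp_le (A : Matrix (Fin n) (Fin n) ℝ) : ‖NormedSpace.exp A‖ ≤ Real.exp ‖A‖ := by
  have h1 := NormedSpace.exp_series_hasSum_exp' (𝕂 := ℝ) A
  have h2 := NormedSpace.exp_series_hasSum_exp' (𝕂 := ℝ) ‖A‖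
  rw [Real.exp_eq_exp_ℝ]
  refine h1.norm_le_of_bounded h2 fun m => ?_
  rw [norm_smul, Real.norm_of_nonneg (by positivity), smul_eq_mul]
  exact mul_le_mul_of_nonneg_left (l2_norm_pow_le A m) (by positivity)

theorem l2_norm_matExp_le (A : Matrix (Fin n) (Fin n) ℝ) {K c t : ℝ} (hA : ‖A‖ ≤ K)
    (ht : |t| ≤ c) : ‖matExp t A‖ ≤ Real.exp (c * K) := by
  refine (l2_norm_exp_le _).trans (Real.exp_le_exp.2 ?_)
  rw [norm_smul, Real.norm_eq_abs]
  exact mul_le_mul ht hA (norm_nonneg _) ((abs_nonneg _).trans ht)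

/-- Mean value inequality, with derivative `e^{tA} A`. -/
theorem l2_norm_matExp_sub_le (A : Matrix (Fin n) (Fin n) ℝ) {K c s t : ℝ} (hA : ‖A‖ ≤ K)
    (hs : s ∈ Set.Icc (-c) c) (ht : t ∈ Set.Icc (-c) c) :
    ‖matExp t A - matExp s A‖ ≤ Real.exp (c * K) * K * |t - s| := by
  refine (convex_Icc (-c) c).norm_image_sub_le_of_norm_hasDerivWithin_le
    (f := fun t : ℝ => matExp t A) (f' := fun t => matExp t A * A)
    (fun u hu => (hasDerivAt_exp_smul_const A u).hasDerivWithinAt) (fun u hu => ?_) hs ht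
  refine (norm_mul_le _ _).trans (mul_le_mul ?_ hA (norm_nonneg _) (Real.exp_nonneg _))
  exact l2_norm_matExp_le A hA (abs_le.2 hu)

theorem matExp_add (A : Matrix (Fin n) (Fin n) ℝ) (s t : ℝ) :
    matExp (s + t) A = matExp s A * matExp t A := by
  rw [matExp, add_smul, Matrix.exp_add_of_commute _ _ (((Commute.refl A).smul_left s).smul_right t)]
  rfl

theorem matExp_zero (A : Matrix (Fin n) (Fin n) ℝ) : matExp 0 A = 1 := by
  simp [matExp, NormedSpace.exp_zero]

theorem matExp_neg_mul (A : Matrix (Fin n) (Fin n) ℝ) (s : ℝ) :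
    matExp (-s) A * matExp s A = 1 := by
  rw [← matExp_add, neg_add_cancel, matExp_zero]

end Norms

/-! ### From pointwise to uniform convergence in probability. -/

section UniformLLN

variable {Ω : Type*} [MeasurableSpace Ω] {μ : Measure Ω}

theorem measure_ge_le_ofReal_integral_div {f : Ω → ℝ} (hf : Integrable f μ)
    [IsFiniteMeasure μ] (h0 : ∀ ω, 0 ≤ f ω) {ε : ℝ} (hε : 0 < ε) :
    μ {ω | ε ≤ f ω} ≤ ENNReal.ofReal ((∫ ω, f ω ∂μ) / ε) := by
  have h := mul_meas_ge_le_integral_of_nonneg (Eventually.of_forall h0) hf ε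
  rw [← ENNReal.ofReal_toReal (measure_ne_top μ {ω | ε ≤ f ω})]
  apply ENNReal.ofReal_le_ofReal
  rw [le_div_iff₀ hε, mul_comm]
  exact h

/-- Pointwise convergence in probability is uniform over a totally bounded set when the paths are
Lipschitz with constants that are bounded in mean. -/
theorem uniform_tendsto_of_lipschitz [IsFiniteMeasure μ] {P : Type*} [PseudoMetricSpace P]
    {S : Set P} (hS : TotallyBounded S) {q : ℕ → P → Ω → ℝ} {Z : ℕ → Ω → ℝ} {C : ℝ}
    (hZ : ∀ n, Integrable (Z n) μ) (hZ0 : ∀ n ω, 0 ≤ Z n ω) (hZC : ∀ n, ∫ ω, Z n ω ∂μ ≤ C)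
    (hq : ∀ n, ∀ p ∈ S, Integrable (q n p) μ)
    (hlip : ∀ n, ∀ p ∈ S, ∀ p' ∈ S, ∀ ω, |q n p ω - q n p' ω| ≤ Z n ω * dist p p')
    (hpt : ∀ p ∈ S, ∀ ε : ℝ, 0 < ε →
      Tendsto (fun n => μ {ω | ε ≤ |q n p ω - ∫ ω', q n p ω' ∂μ|}) atTop (𝓝 0))
    {ε : ℝ} (hε : 0 < ε) :
    Tendsto (fun n => μ {ω | ∃ p ∈ S, ε ≤ |q n p ω - ∫ ω', q n p ω' ∂μ|}) atTop (𝓝 0) := by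
  have hC : 0 ≤ C := (integral_nonneg (hZ0 0)).trans (hZC 0)
  rw [ENNReal.tendsto_nhds_zero]
  intro τ hτ
  have hτ2 : 0 < τ / 2 := ENNReal.half_pos hτ.ne'
  -- The mesh `η` makes the oscillation of the means less than `ε / 3`, and, by Markov, that of the
  -- paths too, outside an event of probability at most `τ / 2`.
  obtain ⟨η, ⟨h1, h2⟩, hη⟩ : ∃ η : ℝ, (C * η < ε / 3 ∧
      ENNReal.ofReal (C / (ε / 3 / η)) < τ / 2) ∧ 0 < η := by
    have t1 : Tendsto (fun η : ℝ => C * η) (𝓝[>] 0) (𝓝 0) := by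
      have : Tendsto (fun η : ℝ => C * η) (𝓝 0) (𝓝 (C * 0)) := tendsto_id.const_mul C
      rw [mul_zero] at this
      exact this.mono_left nhdsWithin_le_nhds
    have t2 : Tendsto (fun η : ℝ => ENNReal.ofReal (C / (ε / 3 / η))) (𝓝[>] 0) (𝓝 0) := by
      have : Tendsto (fun η : ℝ => C / (ε / 3 / η)) (𝓝[>] 0) (𝓝 0) := by
        have := t1.div_const (ε / 3)
        rw [zero_div] at this
        refine this.congr fun η => ?_
        rw [div_div_eq_mul_div C]
      simpa using ENNReal.tendsto_ofReal this
    exact (((t1.eventually_lt_const (by positivity)).and (t2.eventually_lt_const hτ2)).and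
      self_mem_nhdsWithin).exists
  obtain ⟨t, htS, htf, hcov⟩ := Metric.finite_approx_of_totallyBounded hS η hη
  have hsum : Tendsto (fun n => ∑ y ∈ htf.toFinset,
      μ {ω | ε / 3 ≤ |q n y ω - ∫ ω', q n y ω' ∂μ|}) atTop (𝓝 0) := by
    rw [show (0 : ENNReal) = ∑ y ∈ htf.toFinset, 0 by simp]
    exact tendsto_finsetSum _ fun y hy =>
      hpt y (htS (htf.mem_toFinset.1 hy)) _ (by positivity)
  filter_upwards [hsum.eventually_lt_const hτ2] with n hn
  -- Off the right-hand side, compare `p` with a net point `y`: path increment, deviation at `y` and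
  -- increment of the mean each stay below `ε / 3`.
  have hsub : {ω | ∃ p ∈ S, ε ≤ |q n p ω - ∫ ω', q n p ω' ∂μ|} ⊆
      {ω | ε / 3 / η ≤ Z n ω} ∪
        ⋃ y ∈ htf.toFinset, {ω | ε / 3 ≤ |q n y ω - ∫ ω', q n y ω' ∂μ|} := by
    rintro ω ⟨p, hp, hpω⟩
    by_contra hcon
    simp only [Set.mem_union, Set.mem_ofPred_eq, Set.mem_iUnion, not_or, not_le, not_exists] at hcon
    obtain ⟨hz, hy⟩ := hcon
    obtain ⟨y, hyt, hyp⟩ := Set.mem_iUnion₂.1 (hcov hp)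
    have hyy := hy y (htf.mem_toFinset.2 hyt)
    have hd : dist p y ≤ η := (Metric.mem_ball.1 hyp).le
    rw [lt_div_iff₀ hη] at hz
    have b1 : |q n p ω - q n y ω| < ε / 3 :=
      ((hlip n p hp y (htS hyt) ω).trans (mul_le_mul_of_nonneg_left hd (hZ0 n ω))).trans_lt hz
    have b2 : |(∫ ω', q n p ω' ∂μ) - ∫ ω', q n y ω' ∂μ| < ε / 3 := by
      rw [← integral_sub (hq n p hp) (hq n y (htS hyt))]
      refine lt_of_le_of_lt ?_ h1
      calc |∫ ω', (q n p ω' - q n y ω') ∂μ| ≤ ∫ ω', |q n p ω' - q n y ω'| ∂μ :=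
            abs_integral_le_integral_abs
        _ ≤ ∫ ω', Z n ω' * η ∂μ := by
            refine integral_mono ((hq n p hp).sub (hq n y (htS hyt))).abs
              ((hZ n).mul_const η) fun ω' => ?_
            exact (hlip n p hp y (htS hyt) ω').trans (mul_le_mul_of_nonneg_left hd (hZ0 n ω'))
        _ ≤ C * η := by
            rw [integral_mul_const]
            exact mul_le_mul_of_nonneg_right (hZC n) hη.le
    rw [abs_lt] at b1 b2 hyy
    have : |q n p ω - ∫ ω', q n p ω' ∂μ| < ε := by
      rw [abs_lt]; constructor <;> linarith [b1.1, b1.2, b2.1, b2.2, hyy.1, hyy.2]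
    exact absurd hpω (not_le.2 this)
  calc μ _ ≤ μ _ := measure_mono hsub
    _ ≤ μ {ω | ε / 3 / η ≤ Z n ω} +
        ∑ y ∈ htf.toFinset, μ {ω | ε / 3 ≤ |q n y ω - ∫ ω', q n y ω' ∂μ|} :=
      (measure_union_le _ _).trans (add_le_add le_rfl (measure_biUnion_finset_le _ _))
    _ ≤ τ / 2 + τ / 2 := by
      refine add_le_add ?_ hn.le
      refine (measure_ge_le_ofReal_integral_div (hZ n) (hZ0 n) (by positivity)).trans
        (le_trans ?_ h2.le)
      apply ENNReal.ofReal_le_ofReal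
      gcongr
      exact hZC n
    _ = τ := ENNReal.add_halves τ

end UniformLLN

/-! ### Calculus of families that are bounded and Lipschitz uniformly in the sample size. -/

section Families

open scoped Matrix.Norms.L2Operator

variable {P : Type*} [PseudoMetricSpace P] {S : Set P}

/-- Families of functions, indexed by the sample size, that are bounded and Lipschitz on `S` with
constants that do not depend on the sample size. -/
def BddLip (S : Set P) {E : ℕ → Type*} [∀ n, SeminormedAddCommGroup (E n)]
    (f : ∀ n, P → E n) : Prop :=
  ∃ K : ℝ, 0 ≤ K ∧ ∀ n, (∀ p ∈ S, ‖f n p‖ ≤ K) ∧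
    ∀ p ∈ S, ∀ q ∈ S, ‖f n p - f n q‖ ≤ K * dist p q

namespace BddLip

variable {E F G : ℕ → Type*} [∀ n, SeminormedAddCommGroup (E n)]
  [∀ n, SeminormedAddCommGroup (F n)] [∀ n, SeminormedAddCommGroup (G n)]

theorem const {x : ∀ n, E n} {K : ℝ} (hx : ∀ n, ‖x n‖ ≤ K) : BddLip S (fun n _ => x n) :=
  ⟨K, (norm_nonneg _).trans (hx 0), fun n => ⟨fun _ _ => hx n, fun p _ q _ => by
    simpa using mul_nonneg ((norm_nonneg _).trans (hx 0)) dist_nonneg⟩⟩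

theorem add {f g : ∀ n, P → E n} (hf : BddLip S f) (hg : BddLip S g) :
    BddLip S (fun n p => f n p + g n p) := by
  obtain ⟨K, hK, h⟩ := hf
  obtain ⟨L, hL, h'⟩ := hg
  refine ⟨K + L, by positivity, fun n => ⟨fun p hp => ?_, fun p hp q hq => ?_⟩⟩
  · exact (norm_add_le _ _).trans (add_le_add ((h n).1 p hp) ((h' n).1 p hp))
  · rw [add_sub_add_comm, add_mul]
    exact (norm_add_le _ _).trans (add_le_add ((h n).2 p hp q hq) ((h' n).2 p hp q hq))

theorem comp {f : ∀ n, P → E n} (hf : BddLip S f) (φ : ∀ n, E n → F n)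
    (hφ : ∀ n x, ‖φ n x‖ ≤ ‖x‖) (hsub : ∀ n x y, φ n x - φ n y = φ n (x - y)) :
    BddLip S (fun n p => φ n (f n p)) := by
  obtain ⟨K, hK, h⟩ := hf
  refine ⟨K, hK, fun n => ⟨fun p hp => (hφ n _).trans ((h n).1 p hp), fun p hp q hq => ?_⟩⟩
  rw [hsub]
  exact (hφ n _).trans ((h n).2 p hp q hq)

theorem sub {f g : ∀ n, P → E n} (hf : BddLip S f) (hg : BddLip S g) :
    BddLip S (fun n p => f n p - g n p) := by
  simp_rw [sub_eq_add_neg]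
  exact hf.add (hg.comp (fun n x => -x) (fun n x => (norm_neg x).le) fun n x y => by abel)

/-- The product rule, stated once so that it covers matrix products, matrix-vector products, inner
products and scalar multiples. The factor `2` comes from the two increments. -/
theorem bilinear {f : ∀ n, P → E n} {g : ∀ n, P → F n} (hf : BddLip S f) (hg : BddLip S g)
    (b : ∀ n, E n → F n → G n) (hb : ∀ n x y, ‖b n x y‖ ≤ ‖x‖ * ‖y‖)
    (hl : ∀ n x x' y, b n x y - b n x' y = b n (x - x') y)
    (hr : ∀ n x y y', b n x y - b n x y' = b n x (y - y')) :
    BddLip S (fun n p => b n (f n p) (g n p)) := by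
  obtain ⟨K, hK, h⟩ := hf
  obtain ⟨L, hL, h'⟩ := hg
  refine ⟨2 * (K * L), by positivity, fun n => ⟨fun p hp => ?_, fun p hp q hq => ?_⟩⟩
  · refine (hb n _ _).trans ((mul_le_mul ((h n).1 p hp) ((h' n).1 p hp) (norm_nonneg _) hK).trans ?_)
    nlinarith [mul_nonneg hK hL]
  · rw [← sub_add_sub_cancel _ (b n (f n q) (g n p)) _, hl, hr]
    refine (norm_add_le _ _).trans ((add_le_add (hb n _ _) (hb n _ _)).trans ?_)
    have e1 := mul_le_mul ((h n).2 p hp q hq) ((h' n).1 p hp) (norm_nonneg _) (by positivity)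
    have e2 := mul_le_mul ((h n).1 q hq) ((h' n).2 p hp q hq) (norm_nonneg _) hK
    linarith

theorem mul {f g : ∀ n, P → Matrix (Fin n) (Fin n) ℝ} (hf : BddLip S f) (hg : BddLip S g) :
    BddLip S (fun n p => f n p * g n p) :=
  hf.bilinear hg (fun _ x y => x * y) (fun _ x y => norm_mul_le x y)
    (fun _ x x' y => (sub_mul x x' y).symm) (fun _ x y y' => (mul_sub x y y').symm)

theorem mulVec {f : ∀ n, P → Matrix (Fin n) (Fin n) ℝ} {g : ∀ n, P → EuclideanSpace ℝ (Fin n)}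
    (hf : BddLip S f) (hg : BddLip S g) :
    BddLip S (fun n p => WithLp.toLp 2 (f n p *ᵥ (g n p).ofLp)) :=
  hf.bilinear hg (fun _ x y => WithLp.toLp 2 (x *ᵥ y.ofLp)) (fun _ x y => l2_norm_mulVec_le x y)
    (fun _ x x' y => by rw [Matrix.sub_mulVec]; rfl)
    (fun _ x y y' => by rw [WithLp.ofLp_sub, Matrix.mulVec_sub]; rfl)

theorem real_inner {f g : ∀ n, P → EuclideanSpace ℝ (Fin n)} (hf : BddLip S f) (hg : BddLip S g) :
    BddLip (E := fun _ => ℝ) S (fun n p => inner ℝ (f n p) (g n p)) :=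
  hf.bilinear hg (fun _ x y => inner ℝ x y) (fun _ x y => norm_inner_le_norm x y)
    (fun _ x x' y => (inner_sub_left x x' y).symm) (fun _ x y y' => (inner_sub_right x y y').symm)

theorem smul {f : ∀ _ : ℕ, P → ℝ} {g : ∀ n, P → EuclideanSpace ℝ (Fin n)}
    (hf : BddLip S f) (hg : BddLip S g) : BddLip S (fun n p => f n p • g n p) :=
  hf.bilinear hg (fun _ x y => x • y) (fun _ x y => norm_smul_le x y)
    (fun _ x x' y => (sub_smul x x' y).symm) (fun _ x y y' => (smul_sub x y y').symm)

theorem sum {κ : Type*} (s : Finset κ) {f : κ → ∀ n, P → E n} (hf : ∀ i, BddLip S (f i)) :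
    BddLip S (fun n p => ∑ i ∈ s, f i n p) := by
  classical
  induction s using Finset.induction_on with
  | empty => exact ⟨0, le_rfl, fun n => by simp⟩
  | insert i s hi ih =>
    simp_rw [Finset.sum_insert hi]
    exact (hf i).add ih

theorem diagonal_diag {f : ∀ n, P → Matrix (Fin n) (Fin n) ℝ} (hf : BddLip S f) :
    BddLip S (fun n p => Matrix.diagonal (f n p).diag) :=
  hf.comp (fun _ x => Matrix.diagonal x.diag) (fun _ x => l2_norm_diagonal_diag_le x)
    fun _ x y => by rw [Matrix.diag_sub]; exact Matrix.diagonal_sub _ _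

theorem matExp {A : ∀ n, Matrix (Fin n) (Fin n) ℝ} {K c : ℝ} (hA : ∀ n, ‖A n‖ ≤ K) {t : P → ℝ}
    (ht : ∀ p ∈ S, t p ∈ Set.Icc (-c) c) (htl : ∀ p q, |t p - t q| ≤ dist p q) :
    BddLip S (fun n p => MESS.matExp (t p) (A n)) := by
  have hK : 0 ≤ K := (norm_nonneg _).trans (hA 0)
  have e0 := Real.exp_nonneg (c * K)
  -- The summand `1` covers the bound on the exponential, the summand `K` its Lipschitz constant.
  refine ⟨Real.exp (c * K) * (1 + K), by positivity, fun n => ⟨fun p hp => ?_,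
    fun p hp q hq => ?_⟩⟩
  · refine (l2_norm_matExp_le _ (hA n) (abs_le.2 (ht p hp))).trans ?_
    nlinarith
  · refine (l2_norm_matExp_sub_le _ (hA n) (ht q hq) (ht p hp)).trans ?_
    have := htl p q
    have := abs_nonneg (t p - t q)
    gcongr
    linarith

theorem abs_apply {f : ∀ _ : ℕ, P → ℝ} (hf : BddLip S f) :
    ∃ K : ℝ, 0 ≤ K ∧ ∀ n, ∀ p ∈ S, |f n p| ≤ K := by
  obtain ⟨K, hK, h⟩ := hf
  exact ⟨K, hK, fun n => (h n).1⟩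

end BddLip

end Families

/-! ### Law of large numbers for bilinear forms in affine functions of the errors. -/

section BilinearForms

open scoped Matrix.Norms.L2Operator

variable {Ω : Type*} [MeasurableSpace Ω] {μ : Measure Ω}

/-- The vector `x / √n`, so that the squared Euclidean norm becomes an average of squares. -/
noncomputable def nvec {n : ℕ} (x : Fin n → ℝ) : EuclideanSpace ℝ (Fin n) :=
  (√(n : ℝ))⁻¹ • WithLp.toLp 2 x

/-- The random vector `a + B x`. -/
noncomputable def affineVec {n : ℕ} (a : EuclideanSpace ℝ (Fin n)) (B : Matrix (Fin n) (Fin n) ℝ)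
    (x : EuclideanSpace ℝ (Fin n)) : EuclideanSpace ℝ (Fin n) :=
  a + WithLp.toLp 2 (B *ᵥ x.ofLp)

theorem norm_nvec_sq {n : ℕ} (x : Fin n → ℝ) : ‖nvec x‖ ^ 2 = (n : ℝ)⁻¹ * ∑ i, x i ^ 2 := by
  rw [nvec, norm_smul, mul_pow, EuclideanSpace.real_norm_sq_eq, norm_inv, inv_pow,
    Real.norm_of_nonneg (Real.sqrt_nonneg _), Real.sq_sqrt (Nat.cast_nonneg n)]

theorem norm_nvec_le {n : ℕ} {x : Fin n → ℝ} {C : ℝ} (hC : 0 ≤ C) (hx : ∀ i, |x i| ≤ C) :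
    ‖nvec x‖ ≤ C := by
  refine le_of_sq_le_sq ?_ hC
  rw [norm_nvec_sq]
  have : ∑ i, x i ^ 2 ≤ n * C ^ 2 := by
    calc ∑ i, x i ^ 2 ≤ ∑ i : Fin n, C ^ 2 :=
          Finset.sum_le_sum fun i _ => sq_le_sq' (abs_le.1 (hx i)).1 (abs_le.1 (hx i)).2
      _ = n * C ^ 2 := by simp
  rcases Nat.eq_zero_or_pos n with h | h
  · subst h; simp; positivity
  · rw [inv_mul_le_iff₀ (by positivity)]
    exact this

theorem inner_nvec {n : ℕ} (x y : Fin n → ℝ) :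
    inner ℝ (nvec x) (nvec y) = (n : ℝ)⁻¹ * (x ⬝ᵥ y) := by
  rw [nvec, nvec, real_inner_smul_left, real_inner_smul_right, ← mul_assoc, ← mul_inv,
    Real.mul_self_sqrt (Nat.cast_nonneg n), EuclideanSpace.inner_toLp_toLp]
  simp [dotProduct_comm]

theorem nvec_mulVec {n : ℕ} (A : Matrix (Fin n) (Fin n) ℝ) (x : Fin n → ℝ) :
    nvec (A *ᵥ x) = WithLp.toLp 2 (A *ᵥ (nvec x).ofLp) := by
  simp [nvec, Matrix.mulVec_smul]

theorem nvec_add {n : ℕ} (x y : Fin n → ℝ) : nvec (x + y) = nvec x + nvec y := by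
  simp [nvec]

theorem norm_affineVec_le {n : ℕ} {a x : EuclideanSpace ℝ (Fin n)}
    {B : Matrix (Fin n) (Fin n) ℝ} {K : ℝ} (ha : ‖a‖ ≤ K) (hB : ‖B‖ ≤ K) :
    ‖affineVec a B x‖ ≤ K * (1 + ‖x‖) := by
  rw [mul_add, mul_one]
  exact (norm_add_le _ _).trans (add_le_add ha ((l2_norm_mulVec_le B x.ofLp).trans
    (mul_le_mul_of_nonneg_right hB (norm_nonneg _))))

theorem affineVec_sub {n : ℕ} (a a' x : EuclideanSpace ℝ (Fin n))
    (B B' : Matrix (Fin n) (Fin n) ℝ) :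
    affineVec a B x - affineVec a' B' x = affineVec (a - a') (B - B') x := by
  simp only [affineVec, Matrix.sub_mulVec, WithLp.toLp_sub]
  abel

theorem integral_norm_nvec_sq_le {n : ℕ} [IsProbabilityMeasure μ] {V : Ω → Fin n → ℝ}
    (hm : ∀ i, Measurable fun ω => V ω i) (h4 : ∀ i, Integrable (fun ω => V ω i ^ 4) μ) {C : ℝ}
    (hC0 : 0 ≤ C) (hC : ∀ i, ∫ ω, V ω i ^ 4 ∂μ ≤ C) :
    Integrable (fun ω => ‖nvec (V ω)‖ ^ 2) μ ∧ ∫ ω, ‖nvec (V ω)‖ ^ 2 ∂μ ≤ 1 + C := by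
  simp_rw [norm_nvec_sq, sq]
  have h2 := integrable_mul_two (v := fun i ω => V ω i) hm h4
  have hi : Integrable (fun ω => ∑ i, V ω i * V ω i) μ := integrable_finsetSum _ fun i _ => h2 i i
  refine ⟨hi.const_mul _, ?_⟩
  rw [integral_const_mul, integral_finsetSum _ fun i _ => h2 i i]
  have : ∑ i, ∫ ω, V ω i * V ω i ∂μ ≤ n * (1 + C) := by
    calc ∑ i, ∫ ω, V ω i * V ω i ∂μ ≤ ∑ i : Fin n, (1 + C) :=
          Finset.sum_le_sum fun i _ => integral_mul_self_le (v := fun i ω => V ω i) hm h4 hC i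
      _ = n * (1 + C) := by simp; ring
  rcases Nat.eq_zero_or_pos n with h | h
  · subst h; simp; positivity
  · rwa [inv_mul_le_iff₀ (by positivity)]

theorem inner_toLp_mulVec_nvec {n : ℕ} (a : EuclideanSpace ℝ (Fin n))
    (B : Matrix (Fin n) (Fin n) ℝ) (x : Fin n → ℝ) :
    inner ℝ a (WithLp.toLp 2 (B *ᵥ (nvec x).ofLp)) =
      ∑ i, (√(n : ℝ))⁻¹ * (Bᵀ *ᵥ a.ofLp) i * x i := by
  have : inner ℝ a (WithLp.toLp 2 (B *ᵥ (nvec x).ofLp)) =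
      a.ofLp ⬝ᵥ (B *ᵥ (nvec x).ofLp) := by
    rw [← WithLp.toLp_ofLp 2 a, EuclideanSpace.inner_toLp_toLp]
    simp [dotProduct_comm]
  rw [this, Matrix.dotProduct_mulVec, ← Matrix.mulVec_transpose]
  simp only [dotProduct, nvec]
  refine Finset.sum_congr rfl fun i _ => ?_
  simp only [WithLp.ofLp_smul, Pi.smul_apply, smul_eq_mul]
  ring

/-- A bilinear form in affine functions of the errors, written as a quadratic polynomial. -/
theorem inner_affineVec_nvec {n : ℕ} (a₁ a₂ : EuclideanSpace ℝ (Fin n))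
    (B₁ B₂ : Matrix (Fin n) (Fin n) ℝ) (x : Fin n → ℝ) :
    inner ℝ (affineVec a₁ B₁ (nvec x)) (affineVec a₂ B₂ (nvec x)) =
      inner ℝ a₁ a₂ +
      ∑ i, (√(n : ℝ))⁻¹ * ((B₂ᵀ *ᵥ a₁.ofLp) i + (B₁ᵀ *ᵥ a₂.ofLp) i) * x i +
      ∑ i, ∑ j, ((n : ℝ)⁻¹ * (B₁ᵀ * B₂) i j) * (x i * x j) := by
  have e2 : inner ℝ (WithLp.toLp 2 (B₁ *ᵥ (nvec x).ofLp)) (WithLp.toLp 2 (B₂ *ᵥ (nvec x).ofLp)) =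
      ∑ i, ∑ j, ((n : ℝ)⁻¹ * (B₁ᵀ * B₂) i j) * (x i * x j) := by
    rw [← nvec_mulVec, ← nvec_mulVec, inner_nvec, Matrix.dotProduct_mulVec,
      ← Matrix.vecMul_transpose B₁, Matrix.vecMul_vecMul, ← Matrix.dotProduct_mulVec]
    simp only [dotProduct, Matrix.mulVec, Finset.mul_sum]
    exact Finset.sum_congr rfl fun i _ => Finset.sum_congr rfl fun j _ => by ring
  unfold affineVec
  rw [inner_add_left, inner_add_right, inner_add_right, e2, inner_toLp_mulVec_nvec,
    real_inner_comm a₂ (WithLp.toLp 2 (B₁ *ᵥ (nvec x).ofLp)), inner_toLp_mulVec_nvec]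
  simp_rw [mul_add, add_mul, Finset.sum_add_distrib]
  ring

/-- The mean and the variance of a bilinear form in affine functions of the errors. -/
theorem integral_inner_affineVec_centered_sq_le {n : ℕ} [IsProbabilityMeasure μ]
    {V : Ω → Fin n → ℝ} (hm : ∀ i, Measurable fun ω => V ω i)
    (hind : iIndepFun (fun i ω => V ω i) μ) (h0 : ∀ i, ∫ ω, V ω i ∂μ = 0)
    (h4 : ∀ i, Integrable (fun ω => V ω i ^ 4) μ) {C : ℝ}
    (hC0 : 0 ≤ C) (hC : ∀ i, ∫ ω, V ω i ^ 4 ∂μ ≤ C) {a₁ a₂ : EuclideanSpace ℝ (Fin n)}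
    {B₁ B₂ : Matrix (Fin n) (Fin n) ℝ} {K : ℝ} (ha₁ : ‖a₁‖ ≤ K) (ha₂ : ‖a₂‖ ≤ K)
    (hB₁ : ‖B₁‖ ≤ K) (hB₂ : ‖B₂‖ ≤ K) {q : Ω → ℝ}
    (hq : ∀ ω, q ω = inner ℝ (affineVec a₁ B₁ (nvec (V ω))) (affineVec a₂ B₂ (nvec (V ω)))) :
    Integrable q μ ∧ Integrable (fun ω => (q ω - ∫ ω', q ω' ∂μ) ^ 2) μ ∧
      ∫ ω, (q ω - ∫ ω', q ω' ∂μ) ^ 2 ∂μ ≤ (n : ℝ)⁻¹ * (8 * (1 + C) * K ^ 4 + 16 * C * K ^ 4) := by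
  have hK : 0 ≤ K := (norm_nonneg _).trans ha₁
  set l : Fin n → ℝ := fun i => (√(n : ℝ))⁻¹ * ((B₂ᵀ *ᵥ a₁.ofLp) i + (B₁ᵀ *ᵥ a₂.ofLp) i) with hl
  set A : Fin n → Fin n → ℝ := fun i j => (n : ℝ)⁻¹ * (B₁ᵀ * B₂) i j with hA
  have eq : ∀ ω, q ω = inner ℝ a₁ a₂ + ∑ i, l i * V ω i + ∑ i, ∑ j, A i j * (V ω i * V ω j) :=
    fun ω => by rw [hq, inner_affineVec_nvec]
  have i1 : ∀ i, Integrable (fun ω => V ω i) μ :=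
    integrable_of_pow_four (v := fun i ω => V ω i) hm h4
  have i2 : ∀ i j, Integrable (fun ω => V ω i * V ω j) μ :=
    integrable_mul_two (v := fun i ω => V ω i) hm h4
  have iL : Integrable (fun ω => ∑ i, l i * V ω i) μ :=
    integrable_finsetSum _ fun i _ => (i1 i).const_mul _
  have iQ : Integrable (fun ω => ∑ i, ∑ j, A i j * (V ω i * V ω j)) μ :=
    integrable_finsetSum _ fun i _ => integrable_finsetSum _ fun j _ => (i2 i j).const_mul _
  have iLc : Integrable (fun ω => inner ℝ a₁ a₂ + ∑ i, l i * V ω i) μ := (integrable_const _).add iL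
  have iq : Integrable q μ := by
    rw [show q = _ from funext eq]
    exact iLc.add iQ
  have Eq : ∫ ω, q ω ∂μ = inner ℝ a₁ a₂ + ∑ i, ∑ j, A i j * ∫ ω, V ω i * V ω j ∂μ := by
    simp_rw [eq]
    rw [integral_add iLc iQ, integral_add (integrable_const _) iL,
      integral_finsetSum _ fun i _ => (i1 i).const_mul _,
      integral_finsetSum _ fun i _ => integrable_finsetSum _ fun j _ => (i2 i j).const_mul _]
    simp_rw [integral_const_mul, h0, integral_finsetSum _ fun j _ => (i2 _ j).const_mul _,
      integral_const_mul]
    simp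
  obtain ⟨sL, bL⟩ := integral_linear_sq_le (v := fun i ω => V ω i) hm hind h0 h4 hC l
  obtain ⟨sQ, bQ⟩ := integral_quadratic_centered_sq_le (v := fun i ω => V ω i) hm hind h0 h4 hC A
  have ec : ∀ ω, q ω - ∫ ω', q ω' ∂μ = ∑ i, l i * V ω i +
      ∑ i, ∑ j, A i j * (V ω i * V ω j - ∫ ω', V ω' i * V ω' j ∂μ) := fun ω => by
    rw [Eq, eq]
    simp_rw [mul_sub, Finset.sum_sub_distrib]
    ring
  -- The inequality `(x + y)² ≤ 2x² + 2y²` separates the linear from the centred quadratic part, so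
  -- third moments are not needed.
  have hle : ∀ ω, (q ω - ∫ ω', q ω' ∂μ) ^ 2 ≤ 2 * (∑ i, l i * V ω i) ^ 2 +
      2 * (∑ i, ∑ j, A i j * (V ω i * V ω j - ∫ ω', V ω' i * V ω' j ∂μ)) ^ 2 := fun ω => by
    rw [ec]
    nlinarith [sq_nonneg (∑ i, l i * V ω i -
      ∑ i, ∑ j, A i j * (V ω i * V ω j - ∫ ω', V ω' i * V ω' j ∂μ))]
  have isum := (sL.const_mul 2).add (sQ.const_mul 2)
  have isq : Integrable (fun ω => (q ω - ∫ ω', q ω' ∂μ) ^ 2) μ := by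
    refine isum.mono' ((iq.aestronglyMeasurable.sub aestronglyMeasurable_const).pow 2)
      (Eventually.of_forall fun ω => ?_)
    rw [Real.norm_of_nonneg (sq_nonneg _)]
    exact hle ω
  refine ⟨iq, isq, (integral_mono isq isum hle).trans ?_⟩
  simp only [Pi.add_apply]
  rw [integral_add (sL.const_mul 2) (sQ.const_mul 2), integral_const_mul, integral_const_mul]
  have hlsum : ∑ i, l i ^ 2 ≤ (n : ℝ)⁻¹ * (4 * K ^ 4) := by
    have e : ∑ i, l i ^ 2 = (n : ℝ)⁻¹ *
        ‖WithLp.toLp 2 (B₂ᵀ *ᵥ a₁.ofLp) + WithLp.toLp 2 (B₁ᵀ *ᵥ a₂.ofLp)‖ ^ 2 := by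
      rw [EuclideanSpace.real_norm_sq_eq, Finset.mul_sum]
      refine Finset.sum_congr rfl fun i _ => ?_
      simp only [hl, mul_pow, inv_pow, Real.sq_sqrt (Nat.cast_nonneg n)]
      rfl
    rw [e]
    refine mul_le_mul_of_nonneg_left ?_ (by positivity)
    have b1 : ‖WithLp.toLp 2 (B₂ᵀ *ᵥ a₁.ofLp)‖ ≤ K * K :=
      (l2_norm_mulVec_le _ _).trans (mul_le_mul ((l2_norm_transpose B₂).le.trans hB₂) ha₁
        (norm_nonneg _) hK)
    have b2 : ‖WithLp.toLp 2 (B₁ᵀ *ᵥ a₂.ofLp)‖ ≤ K * K :=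
      (l2_norm_mulVec_le _ _).trans (mul_le_mul ((l2_norm_transpose B₁).le.trans hB₁) ha₂
        (norm_nonneg _) hK)
    calc _ ≤ (K * K + K * K) ^ 2 :=
          pow_le_pow_left₀ (norm_nonneg _) ((norm_add_le _ _).trans (add_le_add b1 b2)) 2
      _ = 4 * K ^ 4 := by ring
  -- The coefficients carry `n⁻²` after squaring, and the sum of squared entries costs only one
  -- factor `n`.
  have hAsum : ∑ i, ∑ j, A i j ^ 2 ≤ (n : ℝ)⁻¹ * K ^ 4 := by
    have e : ∑ i, ∑ j, A i j ^ 2 = ((n : ℝ)⁻¹) ^ 2 * ∑ i, ∑ j, (B₁ᵀ * B₂) i j ^ 2 := by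
      simp only [hA, mul_pow, Finset.mul_sum]
    have hN : ‖B₁ᵀ * B₂‖ ≤ K * K := (norm_mul_le _ _).trans
      (mul_le_mul ((l2_norm_transpose B₁).le.trans hB₁) hB₂ (norm_nonneg _) hK)
    rw [e]
    calc _ ≤ ((n : ℝ)⁻¹) ^ 2 * (n * (K * K) ^ 2) := by
          refine mul_le_mul_of_nonneg_left ((sum_sq_le_l2_norm _).trans ?_) (by positivity)
          gcongr
      _ = (n : ℝ)⁻¹ * K ^ 4 := by
          rcases Nat.eq_zero_or_pos n with h | h
          · subst h; simp
          · field_simp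
  have c1 := mul_le_mul_of_nonneg_left hlsum (by positivity : 0 ≤ 1 + C)
  have c2 := mul_le_mul_of_nonneg_left hAsum (by positivity : 0 ≤ 8 * C)
  linarith

variable {P : Type*} [PseudoMetricSpace P] {S : Set P}

/-- Change one factor at a time: each of the two terms is at most `K² d (1 + ‖x‖)²`. Replacing `(1 +
‖x‖)²` by `2 (1 + ‖x‖²)` leaves a quantity whose mean is controlled. -/
theorem abs_inner_affineVec_sub_le {n : ℕ} {a₁ a₂ a₁' a₂' x : EuclideanSpace ℝ (Fin n)}
    {B₁ B₂ B₁' B₂' : Matrix (Fin n) (Fin n) ℝ} {K d : ℝ} (hK : 0 ≤ K) (hd : 0 ≤ d)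
    (ha₂ : ‖a₂‖ ≤ K) (hB₂ : ‖B₂‖ ≤ K) (ha₁' : ‖a₁'‖ ≤ K) (hB₁' : ‖B₁'‖ ≤ K)
    (da₁ : ‖a₁ - a₁'‖ ≤ K * d) (da₂ : ‖a₂ - a₂'‖ ≤ K * d)
    (dB₁ : ‖B₁ - B₁'‖ ≤ K * d) (dB₂ : ‖B₂ - B₂'‖ ≤ K * d) :
    |inner ℝ (affineVec a₁ B₁ x) (affineVec a₂ B₂ x) -
      inner ℝ (affineVec a₁' B₁' x) (affineVec a₂' B₂' x)| ≤ 4 * K ^ 2 * (1 + ‖x‖ ^ 2) * d := by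
  have e : inner ℝ (affineVec a₁ B₁ x) (affineVec a₂ B₂ x) -
      inner ℝ (affineVec a₁' B₁' x) (affineVec a₂' B₂' x) =
      inner ℝ (affineVec a₁ B₁ x - affineVec a₁' B₁' x) (affineVec a₂ B₂ x) +
      inner ℝ (affineVec a₁' B₁' x) (affineVec a₂ B₂ x - affineVec a₂' B₂' x) := by
    rw [inner_sub_left, inner_sub_right]; ring
  rw [e, affineVec_sub, affineVec_sub]
  have n1 := norm_affineVec_le (x := x) da₁ dB₁
  have n2 := norm_affineVec_le (x := x) ha₂ hB₂
  have n3 := norm_affineVec_le (x := x) ha₁' hB₁'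
  have n4 := norm_affineVec_le (x := x) da₂ dB₂
  have hx := norm_nonneg x
  have m1 := (abs_real_inner_le_norm _ _).trans
    (mul_le_mul n1 n2 (norm_nonneg _) (by positivity))
  have m2 := (abs_real_inner_le_norm _ _).trans
    (mul_le_mul n3 n4 (norm_nonneg _) (by positivity))
  refine (abs_add_le _ _).trans ((add_le_add m1 m2).trans ?_)
  have h : (1 + ‖x‖) ^ 2 ≤ 2 * (1 + ‖x‖ ^ 2) := by nlinarith [sq_nonneg (1 - ‖x‖)]
  have := mul_le_mul_of_nonneg_left h (by positivity : 0 ≤ 2 * K ^ 2 * d)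
  nlinarith

/-- Uniform law of large numbers for bilinear forms in affine functions of the errors, together
with a Lipschitz bound on their paths. -/
theorem uniform_lln_inner_affineVec [IsProbabilityMeasure μ] (hS : TotallyBounded S)
    {V : ∀ n : ℕ, Ω → Fin n → ℝ} (hm : ∀ n i, Measurable fun ω => V n ω i)
    (hind : ∀ n, iIndepFun (fun (i : Fin n) ω => V n ω i) μ)
    (h0 : ∀ n i, ∫ ω, V n ω i ∂μ = 0)
    (h4 : ∀ n i, Integrable (fun ω => V n ω i ^ 4) μ) {C : ℝ}
    (hC0 : 0 ≤ C) (hC : ∀ n i, ∫ ω, V n ω i ^ 4 ∂μ ≤ C)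
    {a₁ a₂ : ∀ n, P → EuclideanSpace ℝ (Fin n)} {B₁ B₂ : ∀ n, P → Matrix (Fin n) (Fin n) ℝ}
    (ha₁ : BddLip S a₁) (ha₂ : BddLip S a₂) (hB₁ : BddLip S B₁) (hB₂ : BddLip S B₂)
    {q : ∀ _ : ℕ, P → Ω → ℝ}
    (hq : ∀ n p ω, q n p ω = inner ℝ (affineVec (a₁ n p) (B₁ n p) (nvec (V n ω)))
      (affineVec (a₂ n p) (B₂ n p) (nvec (V n ω)))) :
    (∀ n, ∀ p ∈ S, Integrable (q n p) μ) ∧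
    (∃ K : ℝ, 0 ≤ K ∧ ∀ n, ∀ p ∈ S, ∀ p' ∈ S, ∀ ω,
      |q n p ω - q n p' ω| ≤ K * (1 + ‖nvec (V n ω)‖ ^ 2) * dist p p') ∧
    ∀ ε : ℝ, 0 < ε →
      Tendsto (fun n => μ {ω | ∃ p ∈ S, ε ≤ |q n p ω - ∫ ω', q n p ω' ∂μ|}) atTop (𝓝 0) := by
  obtain ⟨K₁, hK₁, h₁⟩ := ha₁
  obtain ⟨K₂, hK₂, h₂⟩ := ha₂
  obtain ⟨K₃, hK₃, h₃⟩ := hB₁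
  obtain ⟨K₄, hK₄, h₄⟩ := hB₂
  set K := K₁ + K₂ + K₃ + K₄ with hKdef
  have hK : 0 ≤ K := by positivity
  have l1 : K₁ ≤ K := by linarith
  have l2 : K₂ ≤ K := by linarith
  have l3 : K₃ ≤ K := by linarith
  have l4 : K₄ ≤ K := by linarith
  have hpt := fun n p (hp : p ∈ S) => integral_inner_affineVec_centered_sq_le (hm n) (hind n)
    (h0 n) (h4 n) hC0 (hC n) (((h₁ n).1 p hp).trans l1) (((h₂ n).1 p hp).trans l2)
    (((h₃ n).1 p hp).trans l3) (((h₄ n).1 p hp).trans l4) (hq n p)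
  have hlip : ∀ n, ∀ p ∈ S, ∀ p' ∈ S, ∀ ω,
      |q n p ω - q n p' ω| ≤ 4 * K ^ 2 * (1 + ‖nvec (V n ω)‖ ^ 2) * dist p p' := by
    intro n p hp p' hp' ω
    rw [hq, hq]
    have w : ∀ {L : ℝ}, L ≤ K → L * dist p p' ≤ K * dist p p' := fun h =>
      mul_le_mul_of_nonneg_right h dist_nonneg
    exact abs_inner_affineVec_sub_le hK dist_nonneg (((h₂ n).1 p hp).trans l2)
      (((h₄ n).1 p hp).trans l4) (((h₁ n).1 p' hp').trans l1) (((h₃ n).1 p' hp').trans l3)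
      (((h₁ n).2 p hp p' hp').trans (w l1)) (((h₂ n).2 p hp p' hp').trans (w l2))
      (((h₃ n).2 p hp p' hp').trans (w l3)) (((h₄ n).2 p hp p' hp').trans (w l4))
  refine ⟨fun n p hp => (hpt n p hp).1, ⟨4 * K ^ 2, by positivity, hlip⟩, fun ε hε => ?_⟩
  have hv := fun n => integral_norm_nvec_sq_le (hm n) (h4 n) hC0 (hC n)
  refine uniform_tendsto_of_lipschitz hS (Z := fun n ω => 4 * K ^ 2 * (1 + ‖nvec (V n ω)‖ ^ 2))
    (C := 4 * K ^ 2 * (1 + (1 + C))) (fun n => ((integrable_const 1).add (hv n).1).const_mul _)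
    (fun n ω => by positivity) (fun n => ?_) (fun n p hp => (hpt n p hp).1) hlip ?_ hε
  · rw [integral_const_mul, integral_add (integrable_const 1) (hv n).1]
    simp only [integral_const, probReal_univ, smul_eq_mul, one_mul]
    gcongr
    exact (hv n).2
  -- Pointwise convergence is Chebyshev's inequality with the variance bound `D / n`.
  · intro p hp ε hε
    set D : ℝ := 8 * (1 + C) * K ^ 4 + 16 * C * K ^ 4
    have t : Tendsto (fun n : ℕ => ENNReal.ofReal ((n : ℝ)⁻¹ * D / ε ^ 2)) atTop (𝓝 0) := by
      have : Tendsto (fun n : ℕ => (n : ℝ)⁻¹ * D / ε ^ 2) atTop (𝓝 (0 * D / ε ^ 2)) :=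
        ((tendsto_inv_atTop_nhds_zero_nat (𝕜 := ℝ)).mul_const D).div_const _
      simpa using ENNReal.tendsto_ofReal this
    refine tendsto_of_tendsto_of_tendsto_of_le_of_le tendsto_const_nhds t (fun _ => zero_le)
      fun n => ?_
    have hsub : {ω | ε ≤ |q n p ω - ∫ ω', q n p ω' ∂μ|} ⊆
        {ω | ε ^ 2 ≤ (q n p ω - ∫ ω', q n p ω' ∂μ) ^ 2} := fun ω hω => by
      rw [Set.mem_ofPred_eq] at hω ⊢
      rw [← sq_abs (q n p ω - _)]
      exact pow_le_pow_left₀ hε.le hω 2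
    refine (measure_mono hsub).trans ((measure_ge_le_ofReal_integral_div (hpt n p hp).2.1
      (fun ω => sq_nonneg _) (by positivity)).trans (ENNReal.ofReal_le_ofReal ?_))
    gcongr
    exact (hpt n p hp).2.2

end BilinearForms

/-- All matrices, the limits included, lie in a compact cube. The determinant is uniformly
continuous there, so eventually it is at least `δ / 2` in absolute value; the adjugate is bounded
there, and the inverse is their quotient. -/
theorem exists_bound_inv_of_tendstoUniformlyOn {k : ℕ} {F : ℕ → ℝ → Matrix (Fin k) (Fin k) ℝ}
    {L : ℝ → Matrix (Fin k) (Fin k) ℝ} {T : Set ℝ} (hF : TendstoUniformlyOn F L atTop T)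
    {K : ℝ} (hK : ∀ n, ∀ r ∈ T, ∀ i j, |F n r i j| ≤ K) {δ : ℝ} (hδ : 0 < δ)
    (hL : ∀ r ∈ T, δ ≤ |(L r).det|) :
    ∃ C : ℝ, 0 ≤ C ∧ ∀ᶠ n in atTop, ∀ r ∈ T,
      IsUnit (F n r).det ∧ ∀ i j, |(F n r)⁻¹ i j| ≤ C := by
  set Q : Set (Matrix (Fin k) (Fin k) ℝ) := {A | ∀ i j, A i j ∈ Set.Icc (-K) K} with hQ
  have hQc : IsCompact Q := by
    have : Q = Set.pi Set.univ fun _ => Set.pi Set.univ fun _ => Set.Icc (-K) K := by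
      ext A
      exact ⟨fun h i _ j _ => h i j, fun h i j => h i trivial j trivial⟩
    rw [this]
    exact isCompact_univ_pi fun _ => isCompact_univ_pi fun _ => isCompact_Icc
  have hFQ : ∀ n, ∀ r ∈ T, F n r ∈ Q := fun n r hr i j => abs_le.1 (hK n r hr i j)
  have hLQ : ∀ r ∈ T, L r ∈ Q := fun r hr =>
    hQc.isClosed.mem_of_tendsto (hF.tendsto_at hr) (Eventually.of_forall fun n => hFQ n r hr)
  have hdet : UniformContinuousOn (fun A : Matrix (Fin k) (Fin k) ℝ => A.det) Q :=
    hQc.uniformContinuousOn_of_continuous (Continuous.continuousOn (by fun_prop))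
  have hconv := UniformContinuousOn.comp_tendstoUniformlyOn_eventually (s := Q)
    (Eventually.of_forall fun n r hr => hFQ n r hr) hLQ hdet hF
  rw [Metric.tendstoUniformlyOn_iff] at hconv
  obtain ⟨D, hD⟩ := hQc.exists_bound_of_continuousOn
    (f := fun A : Matrix (Fin k) (Fin k) ℝ => ∑ i, ∑ j, |A.adjugate i j|)
    (Continuous.continuousOn (by fun_prop))
  refine ⟨2 / δ * |D|, by positivity, ?_⟩
  filter_upwards [hconv (δ / 2) (by positivity)] with n hn r hr
  have h1 : |(L r).det - (F n r).det| < δ / 2 := hn r hr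
  have h2 := hL r hr
  have h3 : δ / 2 ≤ |(F n r).det| := by
    have := abs_sub_abs_le_abs_sub (L r).det (F n r).det
    linarith
  refine ⟨isUnit_iff_ne_zero.2 fun h => ?_, fun i j => ?_⟩
  · rw [h, abs_zero] at h3; linarith
  · rw [Matrix.inv_def, Ring.inverse_eq_inv', Matrix.smul_apply, smul_eq_mul, abs_mul, abs_inv]
    refine mul_le_mul ?_ ?_ (abs_nonneg _) (by positivity)
    · rw [← inv_div]
      exact inv_anti₀ (by positivity) h3
    · have h4 := hD _ (hFQ n r hr)
      rw [Real.norm_eq_abs] at h4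
      replace h4 := (le_abs_self _).trans h4
      refine le_trans ?_ (h4.trans (le_abs_self D))
      refine (Finset.single_le_sum (f := fun j => |(F n r).adjugate i j|)
        (fun _ _ => abs_nonneg _) (Finset.mem_univ j)).trans ?_
      exact Finset.single_le_sum (f := fun i => ∑ j, |(F n r).adjugate i j|)
        (fun _ _ => Finset.sum_nonneg fun _ _ => abs_nonneg _) (Finset.mem_univ i)

theorem abs_mulVec_le {k : ℕ} {A : Matrix (Fin k) (Fin k) ℝ} {x : Fin k → ℝ} {C η : ℝ}
    (hA : ∀ i j, |A i j| ≤ C) (hx : ∀ j, |x j| ≤ η) (i : Fin k) : |(A *ᵥ x) i| ≤ k * (C * η) := by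
  calc |(A *ᵥ x) i| ≤ ∑ j, |A i j * x j| :=
        Finset.abs_sum_le_sum_abs (fun j => A i j * x j) Finset.univ
    _ ≤ ∑ _j : Fin k, C * η := Finset.sum_le_sum fun j _ => by
        rw [abs_mul]
        exact mul_le_mul (hA i j) (hx j) (abs_nonneg _) ((abs_nonneg _).trans (hA i j))
    _ = k * (C * η) := by simp

/-! ### Residuals, scores and the estimator of `β` in terms of the errors. -/

section Algebra

variable {n k : ℕ}

/-- The coefficient matrix of the errors in the residual. -/
noncomputable def errCoef (W M : Matrix (Fin n) (Fin n) ℝ) (ζ₀ ζ : ℝ × ℝ) :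
    Matrix (Fin n) (Fin n) ℝ :=
  matExp ζ.2 M * matExp (ζ.1 - ζ₀.1) W * matExp (-ζ₀.2) M

/-- The normalized mean of the residual. -/
noncomputable def residMean (W M : Matrix (Fin n) (Fin n) ℝ) (X : Matrix (Fin n) (Fin k) ℝ)
    (β₀ : Fin k → ℝ) (ζ₀ : ℝ × ℝ) (β : Fin k → ℝ) (ζ : ℝ × ℝ) : EuclideanSpace ℝ (Fin n) :=
  WithLp.toLp 2 (matExp ζ.2 M *ᵥ
    (WithLp.toLp 2 (matExp (ζ.1 - ζ₀.1) W *ᵥ (nvec (X *ᵥ β₀)).ofLp) - nvec (X *ᵥ β)).ofLp)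

theorem nvec_sub (x y : Fin n → ℝ) : nvec (x - y) = nvec x - nvec y := by
  simp [nvec, smul_sub]

theorem nvec_mulVec_eq_sum (X : Matrix (Fin n) (Fin k) ℝ) (β : Fin k → ℝ) :
    nvec (X *ᵥ β) = ∑ j, β j • nvec (Xᵀ j) := by
  rw [Matrix.mulVec_eq_sum]
  simp only [nvec, op_smul_eq_smul, WithLp.toLp_sum, Finset.smul_sum, WithLp.toLp_smul]
  exact Finset.sum_congr rfl fun j _ => smul_comm _ _ _

variable {W M : Matrix (Fin n) (Fin n) ℝ} {X : Matrix (Fin n) (Fin k) ℝ} {β₀ : Fin k → ℝ}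
  {ζ₀ : ℝ × ℝ} {y u v : Fin n → ℝ}

theorem matExp_mulVec_outcome (hy : matExp ζ₀.1 W *ᵥ y = X *ᵥ β₀ + u)
    (hu : matExp ζ₀.2 M *ᵥ u = v) (t : ℝ) :
    matExp t W *ᵥ y = matExp (t - ζ₀.1) W *ᵥ (X *ᵥ β₀ + matExp (-ζ₀.2) M *ᵥ v) := by
  rw [← hu, Matrix.mulVec_mulVec, matExp_neg_mul, Matrix.one_mulVec, ← hy, Matrix.mulVec_mulVec,
    ← matExp_add, sub_add_cancel]

theorem nvec_resid (hy : matExp ζ₀.1 W *ᵥ y = X *ᵥ β₀ + u) (hu : matExp ζ₀.2 M *ᵥ u = v)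
    (β : Fin k → ℝ) (ζ : ℝ × ℝ) :
    nvec (resid W M X y β ζ) =
      affineVec (residMean W M X β₀ ζ₀ β ζ) (errCoef W M ζ₀ ζ) (nvec v) := by
  rw [resid, matExp_mulVec_outcome hy hu, affineVec, residMean, ← nvec_mulVec, ← nvec_mulVec,
    ← nvec_sub, ← nvec_mulVec, ← nvec_add]
  congr 1
  simp only [errCoef, Matrix.mulVec_add, Matrix.mulVec_sub, Matrix.mulVec_mulVec, Matrix.mul_assoc]
  abel

theorem nvec_mulVec_affineVec (A B : Matrix (Fin n) (Fin n) ℝ) (a : EuclideanSpace ℝ (Fin n))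
    (x z : Fin n → ℝ) (hz : nvec z = affineVec a B (nvec x)) :
    nvec (A *ᵥ z) = affineVec (WithLp.toLp 2 (A *ᵥ a.ofLp)) (A * B) (nvec x) := by
  rw [nvec_mulVec, hz]
  simp [affineVec, Matrix.mulVec_add]

/-- The outcome enters only through `e^{ρM} e^{λW} y`, the residual at `β = 0`, so both factors are
affine in the errors. -/
theorem scoreLam_eq (hy : matExp ζ₀.1 W *ᵥ y = X *ᵥ β₀ + u) (hu : matExp ζ₀.2 M *ᵥ u = v)
    (β : Fin k → ℝ) (ζ : ℝ × ℝ) :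
    -((n : ℝ)⁻¹ * scoreLam W M X y β ζ) =
      inner ℝ (affineVec (residMean W M X β₀ ζ₀ 0 ζ) (errCoef W M ζ₀ ζ) (nvec v))
        (affineVec (WithLp.toLp 2 (WD W M ζ.2 *ᵥ (residMean W M X β₀ ζ₀ β ζ).ofLp))
          (WD W M ζ.2 * errCoef W M ζ₀ ζ) (nvec v)) := by
  rw [← nvec_resid hy hu 0 ζ, ← nvec_mulVec_affineVec _ _ _ _ _ (nvec_resid hy hu β ζ), inner_nvec,
    scoreLam, mul_neg, neg_neg, ← Matrix.transpose_mul, ← Matrix.mulVec_mulVec,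
    Matrix.dotProduct_mulVec, Matrix.vecMul_transpose]
  simp [resid, Matrix.mulVec_mulVec]

theorem scoreRho_eq (hy : matExp ζ₀.1 W *ᵥ y = X *ᵥ β₀ + u) (hu : matExp ζ₀.2 M *ᵥ u = v)
    (β : Fin k → ℝ) (ζ : ℝ × ℝ) :
    -((n : ℝ)⁻¹ * scoreRho W M X y β ζ) =
      inner ℝ (affineVec (residMean W M X β₀ ζ₀ β ζ) (errCoef W M ζ₀ ζ) (nvec v))
        (affineVec (WithLp.toLp 2 (M *ᵥ (residMean W M X β₀ ζ₀ β ζ).ofLp))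
          (M * errCoef W M ζ₀ ζ) (nvec v)) := by
  rw [← nvec_resid hy hu β ζ, ← nvec_mulVec_affineVec _ _ _ _ _ (nvec_resid hy hu β ζ), inner_nvec,
    scoreRho, mul_neg, neg_neg]

theorem smul_gram_apply (M : Matrix (Fin n) (Fin n) ℝ) (X : Matrix (Fin n) (Fin k) ℝ) (r : ℝ)
    (i j : Fin k) :
    ((n : ℝ)⁻¹ • gram M X r) i j =
      inner ℝ (nvec (matExp r M *ᵥ Xᵀ i)) (nvec (matExp r M *ᵥ Xᵀ j)) := by
  rw [inner_nvec, Matrix.smul_apply, smul_eq_mul, gram, ← Matrix.transpose_mul, Matrix.mul_assoc]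
  rfl

/-- The factors `1/n` in the Gram matrix and in the moment vector cancel; both normalized quantities
stay bounded. -/
theorem betaOf_eq (hn : 0 < n) (ζ : ℝ × ℝ) (hdet : IsUnit ((n : ℝ)⁻¹ • gram M X ζ.2).det)
    (y : Fin n → ℝ) :
    betaOf W M X y ζ = ((n : ℝ)⁻¹ • gram M X ζ.2)⁻¹ *ᵥ fun j =>
      inner ℝ (nvec (matExp ζ.2 M *ᵥ Xᵀ j)) (nvec (matExp ζ.2 M *ᵥ (matExp ζ.1 W *ᵥ y))) := by
  have hn' : (n : ℝ) ≠ 0 := by positivity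
  have e : (gram M X ζ.2)⁻¹ = (n : ℝ)⁻¹ • ((n : ℝ)⁻¹ • gram M X ζ.2)⁻¹ := by
    refine Matrix.inv_eq_right_inv ?_
    have := Matrix.mul_nonsing_inv _ hdet
    rwa [Matrix.smul_mul, ← Matrix.mul_smul] at this
  have e2 : (fun j => inner ℝ (nvec (matExp ζ.2 M *ᵥ Xᵀ j))
      (nvec (matExp ζ.2 M *ᵥ (matExp ζ.1 W *ᵥ y)))) =
      (n : ℝ)⁻¹ • ((Xᵀ * (matExp ζ.2 M)ᵀ) *ᵥ (matExp ζ.2 M *ᵥ (matExp ζ.1 W *ᵥ y))) := by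
    ext j
    rw [inner_nvec, ← Matrix.transpose_mul]
    rfl
  rw [e2, betaOf, e, Matrix.mulVec_smul]
  simp only [Matrix.smul_mul, Matrix.smul_mulVec, Matrix.mulVec_mulVec, Matrix.mul_assoc]

end Algebra

theorem HeteroskedasticErrors.exists_four_moment_le {Ω : Type*} [MeasurableSpace Ω] {μ : Measure Ω}
    [IsProbabilityMeasure μ] {V : ∀ n : ℕ, Ω → Fin n → ℝ} (h : HeteroskedasticErrors μ V) :
    ∃ C : ℝ, 0 ≤ C ∧ ∀ n i, Integrable (fun ω => V n ω i ^ 4) μ ∧ ∫ ω, V n ω i ^ 4 ∂μ ≤ C := by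
  obtain ⟨r, hr, C, hC⟩ := h.moment
  have hle : ∀ x : ℝ, x ^ 4 ≤ 1 + |x| ^ (4 + r) := fun x => by
    have h0 : 0 ≤ |x| ^ (4 + r) := Real.rpow_nonneg (abs_nonneg x) _
    rw [← (by decide : Even 4).pow_abs x]
    rcases le_total |x| 1 with h | h
    · have := pow_le_one₀ (n := 4) (abs_nonneg x) h
      linarith
    · have : |x| ^ ((4 : ℕ) : ℝ) ≤ |x| ^ (4 + r) :=
        Real.rpow_le_rpow_of_exponent_le h (by push_cast; linarith)
      rw [Real.rpow_natCast] at this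
      linarith
  refine ⟨1 + |C|, by positivity, fun n i => ?_⟩
  have hi : Integrable (fun ω => 1 + |V n ω i| ^ (4 + r)) μ := (integrable_const 1).add (hC n i).1
  have h4 : Integrable (fun ω => V n ω i ^ 4) μ := by
    refine hi.mono' ((h.measurable n i).pow_const 4).aestronglyMeasurable
      (Eventually.of_forall fun ω => ?_)
    rw [Real.norm_of_nonneg (by positivity)]
    exact hle _
  refine ⟨h4, (integral_mono h4 hi fun ω => hle _).trans ?_⟩
  rw [integral_add (integrable_const 1) (hC n i).1]
  simp only [integral_const, probReal_univ, smul_eq_mul, one_mul]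
  linarith [(hC n i).2, le_abs_self C]

/-! ### The matrices and mean vectors of the model as bounded Lipschitz families. -/

section Families

open scoped Matrix.Norms.L2Operator

theorem BoundedSums.exists_l2_norm_le {A : ∀ n : ℕ, Matrix (Fin n) (Fin n) ℝ}
    (hA : BoundedSums A) : ∃ K : ℝ, 0 ≤ K ∧ ∀ n, ‖A n‖ ≤ K := by
  obtain ⟨K, hr, hc⟩ := hA
  exact ⟨|K|, abs_nonneg K, fun n => l2_norm_le_of_sums _ (abs_nonneg K)
    (fun i => (hr n i).trans (le_abs_self K)) fun j => (hc n j).trans (le_abs_self K)⟩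

variable {P : Type*} [PseudoMetricSpace P] {S : Set P} {k : ℕ}
  {W M : ∀ n : ℕ, Matrix (Fin n) (Fin n) ℝ} {X : ∀ n : ℕ, Matrix (Fin n) (Fin k) ℝ}
  {K c : ℝ} {ζ₀ : ℝ × ℝ} {ζ : P → ℝ × ℝ}

theorem bddLip_matExp_snd (hM : ∀ n, ‖M n‖ ≤ K) (hζ : ∀ p ∈ S, ζ p ∈ paramSpace c)
    (hl : ∀ p q, dist (ζ p) (ζ q) ≤ dist p q) :
    BddLip S (fun n p => matExp (ζ p).2 (M n)) :=
  BddLip.matExp hM (fun p hp => (hζ p hp).2) fun p q => (le_max_right _ _).trans (hl p q)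

theorem bddLip_matExp_fst_sub (hW : ∀ n, ‖W n‖ ≤ K) (hζ : ∀ p ∈ S, ζ p ∈ paramSpace c)
    (hl : ∀ p q, dist (ζ p) (ζ q) ≤ dist p q) (h₀ : ζ₀ ∈ paramSpace c) :
    BddLip S (fun n p => matExp ((ζ p).1 - ζ₀.1) (W n)) := by
  -- Differences of two points of `[-c, c]` lie in `[-2c, 2c]`.
  refine BddLip.matExp (c := 2 * c) hW (fun p hp => ?_) fun p q => ?_
  · have h1 := (hζ p hp).1
    have h2 := h₀.1
    constructor <;> linarith [h1.1, h1.2, h2.1, h2.2]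
  · rw [sub_sub_sub_cancel_right]
    exact (le_max_left _ _).trans (hl p q)

theorem bddLip_errCoef (hW : ∀ n, ‖W n‖ ≤ K) (hM : ∀ n, ‖M n‖ ≤ K)
    (hζ : ∀ p ∈ S, ζ p ∈ paramSpace c) (hl : ∀ p q, dist (ζ p) (ζ q) ≤ dist p q)
    (h₀ : ζ₀ ∈ paramSpace c) :
    BddLip S (fun n p => errCoef (W n) (M n) ζ₀ (ζ p)) :=
  ((bddLip_matExp_snd hM hζ hl).mul (bddLip_matExp_fst_sub hW hζ hl h₀)).mul
    (BddLip.const fun n => l2_norm_matExp_le (c := c) (M n) (hM n)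
      (by rw [abs_neg]; exact abs_le.2 h₀.2))

theorem bddLip_WD (hW : ∀ n, ‖W n‖ ≤ K) (hM : ∀ n, ‖M n‖ ≤ K)
    (hζ : ∀ p ∈ S, ζ p ∈ paramSpace c) (hl : ∀ p q, dist (ζ p) (ζ q) ≤ dist p q) :
    BddLip S (fun n p => WD (W n) (M n) (ζ p).2) := by
  have h1 : BddLip S (fun n p => matExp (-(ζ p).2) (M n)) := by
    refine BddLip.matExp (c := c) hM (fun p hp => ?_) fun p q => ?_
    · have := (hζ p hp).2
      constructor <;> linarith [this.1, this.2]
    · rw [neg_sub_neg, abs_sub_comm]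
      exact (le_max_right _ _).trans (hl p q)
  have h2 : BddLip S (fun n p => WW (W n) (M n) (ζ p).2) :=
    ((bddLip_matExp_snd hM hζ hl).mul (BddLip.const hW)).mul h1
  exact h2.sub h2.diagonal_diag

/-- `X b` is a combination of `k` columns, with `k` fixed, and each column divided by `√n` has norm
at most `CX`. -/
theorem bddLip_nvec_mulVec {CX R : ℝ} (hCX : 0 ≤ CX) (hX : ∀ n i j, |X n i j| ≤ CX)
    {b : P → Fin k → ℝ} (hb : ∀ p ∈ S, ‖b p‖ ≤ R) (hR : 0 ≤ R)
    (hbl : ∀ p q, dist (b p) (b q) ≤ dist p q) :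
    BddLip S (fun n p => nvec (X n *ᵥ b p)) := by
  simp_rw [nvec_mulVec_eq_sum]
  refine BddLip.sum _ fun j => BddLip.smul (f := fun _ p => b p j) ?_
    (BddLip.const fun n => norm_nvec_le hCX fun i => hX n i j)
  refine ⟨R + 1, by positivity, fun n => ⟨fun p hp => ?_, fun p hp q hq => ?_⟩⟩
  · exact (norm_le_pi_norm (b p) j).trans ((hb p hp).trans (by linarith))
  · have := (dist_le_pi_dist (b p) (b q) j).trans (hbl p q)
    rw [dist_eq_norm] at this
    nlinarith [dist_nonneg (x := p) (y := q)]

theorem bddLip_residMean (hW : ∀ n, ‖W n‖ ≤ K) (hM : ∀ n, ‖M n‖ ≤ K)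
    (hζ : ∀ p ∈ S, ζ p ∈ paramSpace c) (hl : ∀ p q, dist (ζ p) (ζ q) ≤ dist p q)
    (h₀ : ζ₀ ∈ paramSpace c) {CX R : ℝ} (hCX : 0 ≤ CX) (hX : ∀ n i j, |X n i j| ≤ CX)
    (β₀ : Fin k → ℝ) {b : P → Fin k → ℝ} (hb : ∀ p ∈ S, ‖b p‖ ≤ R) (hR : 0 ≤ R)
    (hbl : ∀ p q, dist (b p) (b q) ≤ dist p q) :
    BddLip S (fun n p => residMean (W n) (M n) (X n) β₀ ζ₀ (b p) (ζ p)) :=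
  (bddLip_matExp_snd hM hζ hl).mulVec
    (((bddLip_matExp_fst_sub hW hζ hl h₀).mulVec
      (bddLip_nvec_mulVec hCX hX (b := fun _ => β₀) (fun _ _ => le_rfl) (norm_nonneg _)
        fun p q => by simp)).sub (bddLip_nvec_mulVec hCX hX hb hR hbl))

theorem bddLip_regressor (hM : ∀ n, ‖M n‖ ≤ K)
    (hζ : ∀ p ∈ S, ζ p ∈ paramSpace c) (hl : ∀ p q, dist (ζ p) (ζ q) ≤ dist p q)
    {CX : ℝ} (hCX : 0 ≤ CX) (hX : ∀ n i j, |X n i j| ≤ CX) (j : Fin k) :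
    BddLip S (fun n p => nvec (matExp (ζ p).2 (M n) *ᵥ (X n)ᵀ j)) := by
  simp_rw [nvec_mulVec]
  exact (bddLip_matExp_snd hM hζ hl).mulVec
    (BddLip.const (x := fun n => nvec ((X n)ᵀ j)) fun n => norm_nvec_le hCX fun i => hX n i j)

end Families

/-! ### The estimator of `β` and its population counterpart. -/

section Estimator

variable {n k : ℕ} {W M : Matrix (Fin n) (Fin n) ℝ} {X : Matrix (Fin n) (Fin k) ℝ}
  {β₀ : Fin k → ℝ} {ζ₀ ζ : ℝ × ℝ} {y u v : Fin n → ℝ}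

theorem nvec_zero : nvec (0 : Fin n → ℝ) = 0 := by simp [nvec]

/-- The mean of the outcome. -/
noncomputable def meanOutcome (W : Matrix (Fin n) (Fin n) ℝ) (X : Matrix (Fin n) (Fin k) ℝ)
    (β₀ : Fin k → ℝ) (ζ₀ : ℝ × ℝ) : Fin n → ℝ :=
  matExp (-ζ₀.1) W *ᵥ (X *ᵥ β₀)

theorem matExp_mulVec_meanOutcome :
    matExp ζ₀.1 W *ᵥ meanOutcome W X β₀ ζ₀ = X *ᵥ β₀ := by
  have := matExp_neg_mul W (-ζ₀.1)
  rw [neg_neg] at this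
  rw [meanOutcome, Matrix.mulVec_mulVec, this, Matrix.one_mulVec]

theorem nvec_outcome (hy : matExp ζ₀.1 W *ᵥ y = X *ᵥ β₀ + u) (hu : matExp ζ₀.2 M *ᵥ u = v) :
    nvec (matExp ζ.2 M *ᵥ (matExp ζ.1 W *ᵥ y)) =
      affineVec (residMean W M X β₀ ζ₀ 0 ζ) (errCoef W M ζ₀ ζ) (nvec v) := by
  rw [← nvec_resid hy hu 0 ζ, resid, Matrix.mulVec_zero, sub_zero]

theorem nvec_meanOutcome :
    nvec (matExp ζ.2 M *ᵥ (matExp ζ.1 W *ᵥ meanOutcome W X β₀ ζ₀)) =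
      residMean W M X β₀ ζ₀ 0 ζ := by
  rw [nvec_outcome (X := X) (β₀ := β₀) (ζ₀ := ζ₀) (u := 0) (v := 0) (by rw [matExp_mulVec_meanOutcome, add_zero]) (by simp)]
  simp [affineVec, nvec_zero]

/-- The estimator is linear in the outcome, so only the errors remain. The zero matrix and zero
vector put the result in the form required by the law of large numbers. -/
theorem betaOf_sub_betaOf_meanOutcome (hn : 0 < n)
    (hdet : IsUnit ((n : ℝ)⁻¹ • gram M X ζ.2).det)
    (hy : matExp ζ₀.1 W *ᵥ y = X *ᵥ β₀ + u) (hu : matExp ζ₀.2 M *ᵥ u = v) :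
    betaOf W M X y ζ - betaOf W M X (meanOutcome W X β₀ ζ₀) ζ =
      ((n : ℝ)⁻¹ • gram M X ζ.2)⁻¹ *ᵥ fun j =>
        inner ℝ (affineVec (nvec (matExp ζ.2 M *ᵥ Xᵀ j)) 0 (nvec v))
          (affineVec 0 (errCoef W M ζ₀ ζ) (nvec v)) := by
  rw [betaOf_eq hn ζ hdet, betaOf_eq hn ζ hdet, ← Matrix.mulVec_sub]
  congr 1
  ext j
  rw [Pi.sub_apply, nvec_outcome hy hu, nvec_meanOutcome, ← inner_sub_right]
  simp [affineVec]

/-- At `λ = λ₀` the filtered mean is exactly `X β₀`, and weighted least squares recovers `β₀`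
whatever the weight `ρ`. -/
theorem betaOf_meanOutcome_true (hdet : IsUnit (gram M X ζ.2).det) :
    betaOf W M X (meanOutcome W X β₀ ζ₀) (ζ₀.1, ζ.2) = β₀ := by
  rw [betaOf, ← Matrix.mulVec_mulVec]
  simp only [matExp_mulVec_meanOutcome]
  rw [Matrix.mulVec_mulVec]
  have e : (gram M X ζ.2)⁻¹ * Xᵀ * (matExp ζ.2 M)ᵀ * matExp ζ.2 M * X =
      (gram M X ζ.2)⁻¹ * gram M X ζ.2 := by
    simp only [gram, Matrix.mul_assoc]
  rw [e, Matrix.nonsing_inv_mul _ hdet, Matrix.one_mulVec]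

/-- Writing `β₀` as the population value at `(λ₀, ρ)` with the same `ρ` gives both terms the same
Gram matrix. Its inverse then need only be bounded, not Lipschitz. -/
theorem betaOf_meanOutcome_sub (hn : 0 < n) (hdet : IsUnit ((n : ℝ)⁻¹ • gram M X ζ.2).det) :
    betaOf W M X (meanOutcome W X β₀ ζ₀) ζ - β₀ =
      ((n : ℝ)⁻¹ • gram M X ζ.2)⁻¹ *ᵥ fun j =>
        inner ℝ (nvec (matExp ζ.2 M *ᵥ Xᵀ j)) (residMean W M X β₀ ζ₀ 0 ζ) -
        inner ℝ (nvec (matExp ζ.2 M *ᵥ Xᵀ j)) (residMean W M X β₀ ζ₀ 0 (ζ₀.1, ζ.2)) := by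
  have hdet' : IsUnit (gram M X ζ.2).det := by
    rw [Matrix.det_smul] at hdet
    exact isUnit_of_mul_isUnit_right hdet
  have e : betaOf W M X (meanOutcome W X β₀ ζ₀) ζ - β₀ =
      betaOf W M X (meanOutcome W X β₀ ζ₀) ζ -
        betaOf W M X (meanOutcome W X β₀ ζ₀) (ζ₀.1, ζ.2) := by
    rw [betaOf_meanOutcome_true hdet']
  rw [e]
  rw [betaOf_eq hn ζ hdet, betaOf_eq hn (ζ₀.1, ζ.2) hdet, ← Matrix.mulVec_sub]
  congr 1
  ext j
  rw [Pi.sub_apply, nvec_meanOutcome, nvec_meanOutcome]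

theorem integral_outcome {Ω : Type*} [MeasurableSpace Ω] {μ : Measure Ω} [IsProbabilityMeasure μ]
    {Y U V : Ω → Fin n → ℝ} (hy : ∀ ω, matExp ζ₀.1 W *ᵥ Y ω = X *ᵥ β₀ + U ω)
    (hu : ∀ ω, matExp ζ₀.2 M *ᵥ U ω = V ω) (hi : ∀ i, Integrable (fun ω => V ω i) μ)
    (h0 : ∀ i, ∫ ω, V ω i ∂μ = 0) :
    (fun i => ∫ ω, Y ω i ∂μ) = meanOutcome W X β₀ ζ₀ := by
  ext i
  have e : ∀ ω, Y ω i = meanOutcome W X β₀ ζ₀ i +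
      ∑ j, (matExp (-ζ₀.1) W * matExp (-ζ₀.2) M) i j * V ω j := fun ω => by
    have h := matExp_mulVec_outcome (hy ω) (hu ω) 0
    rw [matExp_zero, Matrix.one_mulVec, zero_sub, Matrix.mulVec_add,
      Matrix.mulVec_mulVec (V ω)] at h
    rw [h]
    rfl
  simp_rw [e]
  rw [integral_add (integrable_const _) (integrable_finsetSum _ fun j _ => (hi j).const_mul _),
    integral_finsetSum _ fun j _ => (hi j).const_mul _]
  simp_rw [integral_const_mul, h0]
  simp

theorem integral_inner_linear {Ω : Type*} [MeasurableSpace Ω] {μ : Measure Ω}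
    {V : Ω → Fin n → ℝ} (hi : ∀ i, Integrable (fun ω => V ω i) μ)
    (h0 : ∀ i, ∫ ω, V ω i ∂μ = 0) (a : EuclideanSpace ℝ (Fin n)) (B : Matrix (Fin n) (Fin n) ℝ) :
    ∫ ω, inner ℝ (affineVec a 0 (nvec (V ω))) (affineVec 0 B (nvec (V ω))) ∂μ = 0 := by
  have e : ∀ ω, inner ℝ (affineVec a 0 (nvec (V ω))) (affineVec 0 B (nvec (V ω))) =
      ∑ i, (√(n : ℝ))⁻¹ * (Bᵀ *ᵥ a.ofLp) i * V ω i := fun ω => by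
    rw [← inner_toLp_mulVec_nvec]
    simp [affineVec]
  simp_rw [e]
  rw [integral_finsetSum _ fun j _ => (hi j).const_mul _]
  simp_rw [integral_const_mul, h0]
  simp

end Estimator

theorem norm_popConcScore {Ω : Type*} [MeasurableSpace Ω] (μ : Measure Ω) {n k : ℕ}
    (W M : Matrix (Fin n) (Fin n) ℝ) (X : Matrix (Fin n) (Fin k) ℝ) (Y : Ω → Fin n → ℝ)
    (ζ : ℝ × ℝ) {m : Fin n → ℝ} (hm : (fun i => ∫ ω, Y ω i ∂μ) = m) :
    (n : ℝ)⁻¹ * ‖popConcScore μ W M X Y ζ‖ =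
      max |∫ ω, -((n : ℝ)⁻¹ * scoreLam W M X (Y ω) (betaOf W M X m ζ) ζ) ∂μ|
        |∫ ω, -((n : ℝ)⁻¹ * scoreRho W M X (Y ω) (betaOf W M X m ζ) ζ) ∂μ| := by
  subst hm
  have hn : (0 : ℝ) ≤ (n : ℝ)⁻¹ := by positivity
  simp_rw [integral_neg, integral_const_mul, abs_neg, abs_mul, abs_of_nonneg hn]
  rw [← mul_max_of_nonneg _ _ hn]
  rfl

/-! ### Uniform convergence and consistency. -/

section Consistency

open scoped Matrix.Norms.L2Operator

variable {Ω : Type*} [MeasurableSpace Ω] {μ : Measure Ω} [IsProbabilityMeasure μ] {k : ℕ}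
  {W M : ∀ n : ℕ, Matrix (Fin n) (Fin n) ℝ} {X : ∀ n : ℕ, Matrix (Fin n) (Fin k) ℝ}
  {β₀ : Fin k → ℝ} {ζ₀ : ℝ × ℝ} {Y U V : ∀ n : ℕ, Ω → Fin n → ℝ} {c : ℝ}

theorem isCompact_paramSpace (c : ℝ) : IsCompact (paramSpace c) := isCompact_Icc.prod isCompact_Icc

/-- The average product of the `j`-th transformed regressor with the error part of the residual. -/
noncomputable def regErr {n : ℕ} (W M : Matrix (Fin n) (Fin n) ℝ) (X : Matrix (Fin n) (Fin k) ℝ)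
    (ζ₀ ζ : ℝ × ℝ) (v : Fin n → ℝ) (j : Fin k) : ℝ :=
  inner ℝ (affineVec (nvec (matExp ζ.2 M *ᵥ Xᵀ j)) 0 (nvec v))
    (affineVec 0 (errCoef W M ζ₀ ζ) (nvec v))

/-- The average product of the `j`-th transformed regressor with the mean of the transformed
outcome. -/
noncomputable def regMean {n : ℕ} (W M : Matrix (Fin n) (Fin n) ℝ) (X : Matrix (Fin n) (Fin k) ℝ)
    (β₀ : Fin k → ℝ) (ζ₀ ζ : ℝ × ℝ) (j : Fin k) : ℝ :=
  inner ℝ (nvec (matExp ζ.2 M *ᵥ Xᵀ j)) (residMean W M X β₀ ζ₀ 0 ζ)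

theorem RegularRegressors.exists_abs_le (hX : RegularRegressors M X c) :
    ∃ C : ℝ, 0 ≤ C ∧ ∀ n i j, |X n i j| ≤ C := by
  obtain ⟨C, hC⟩ := hX.bounded
  exact ⟨|C|, abs_nonneg C, fun n i j => (hC n i j).trans (le_abs_self C)⟩

theorem exists_common_l2_norm_le (hW : BoundedSums W) (hM : BoundedSums M) :
    ∃ K : ℝ, (∀ n, ‖W n‖ ≤ K) ∧ ∀ n, ‖M n‖ ≤ K := by
  obtain ⟨K₁, _, h₁⟩ := hW.exists_l2_norm_le
  obtain ⟨K₂, _, h₂⟩ := hM.exists_l2_norm_le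
  exact ⟨max K₁ K₂, fun n => (h₁ n).trans (le_max_left _ _),
    fun n => (h₂ n).trans (le_max_right _ _)⟩

theorem tendsto_regErr (herr : HeteroskedasticErrors μ V) (hW : BoundedSums W)
    (hM : BoundedSums M) (hX : RegularRegressors M X c) (h₀ : ζ₀ ∈ paramSpace c) (j : Fin k)
    {η : ℝ} (hη : 0 < η) :
    Tendsto (fun n => μ {ω | ∃ ζ ∈ paramSpace c, η ≤ |regErr (W n) (M n) (X n) ζ₀ ζ (V n ω) j|})
      atTop (𝓝 0) := by
  obtain ⟨K, hKW, hKM⟩ := exists_common_l2_norm_le hW hM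
  obtain ⟨CX, hCX, hXb⟩ := hX.exists_abs_le
  obtain ⟨C, hC0, hC⟩ := herr.exists_four_moment_le
  have hl : ∀ p q : ℝ × ℝ, dist p q ≤ dist p q := fun _ _ => le_rfl
  have hζ : ∀ p ∈ paramSpace c, p ∈ paramSpace c := fun _ h => h
  have h := (uniform_lln_inner_affineVec (isCompact_paramSpace c).totallyBounded herr.measurable
    herr.indep herr.mean_zero (fun n i => (hC n i).1) hC0 (fun n i => (hC n i).2)
    (bddLip_regressor hKM hζ hl hCX hXb j) (BddLip.const (K := 0) (x := fun n => 0) (by simp))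
    (BddLip.const (K := 0) (x := fun n => 0) (by simp)) (bddLip_errCoef hKW hKM hζ hl h₀)
    (q := fun n ζ ω => regErr (W n) (M n) (X n) ζ₀ ζ (V n ω) j)
    (fun n p ω => rfl)).2.2 η hη
  have e : ∀ n ζ, ∫ ω, regErr (W n) (M n) (X n) ζ₀ ζ (V n ω) j ∂μ = 0 := fun n ζ =>
    integral_inner_linear (integrable_of_pow_four (v := fun i ω => V n ω i) (herr.measurable n)
      fun i => (hC n i).1) (herr.mean_zero n) _ _
  simpa only [e, sub_zero] using h

theorem exists_regMean_lipschitz (β₀ : Fin k → ℝ) (hW : BoundedSums W)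
    (hM : BoundedSums M) (hX : RegularRegressors M X c) (h₀ : ζ₀ ∈ paramSpace c) :
    ∃ K : ℝ, 0 ≤ K ∧ ∀ n, ∀ ζ ∈ paramSpace c, ∀ ζ' ∈ paramSpace c, ∀ j,
      |regMean (W n) (M n) (X n) β₀ ζ₀ ζ j - regMean (W n) (M n) (X n) β₀ ζ₀ ζ' j| ≤
        K * dist ζ ζ' := by
  obtain ⟨K, hKW, hKM⟩ := exists_common_l2_norm_le hW hM
  obtain ⟨CX, hCX, hXb⟩ := hX.exists_abs_le
  have hl : ∀ p q : ℝ × ℝ, dist p q ≤ dist p q := fun _ _ => le_rfl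
  have hζ : ∀ p ∈ paramSpace c, p ∈ paramSpace c := fun _ h => h
  have h : ∀ j, BddLip (E := fun _ => ℝ) (paramSpace c)
      (fun n ζ => regMean (W n) (M n) (X n) β₀ ζ₀ ζ j) := fun j =>
    (bddLip_regressor hKM hζ hl hCX hXb j).real_inner (bddLip_residMean hKW hKM hζ hl h₀ hCX hXb β₀
      (b := fun _ => 0) (R := 0) (by simp) le_rfl (by simp))
  choose L hL0 hL using h
  refine ⟨∑ j, L j, Finset.sum_nonneg fun j _ => hL0 j, fun n ζ h1 ζ' h2 j => ?_⟩
  exact ((hL j n).2 ζ h1 ζ' h2).trans (mul_le_mul_of_nonneg_right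
    (Finset.single_le_sum (fun j _ => hL0 j) (Finset.mem_univ j)) dist_nonneg)

theorem exists_bound_gram_inv (hM : BoundedSums M) (hX : RegularRegressors M X c) :
    ∃ C : ℝ, 0 ≤ C ∧ ∀ᶠ n : ℕ in atTop, ∀ r ∈ Set.Icc (-c) c,
      IsUnit ((n : ℝ)⁻¹ • gram (M n) (X n) r).det ∧
        ∀ i j, |((n : ℝ)⁻¹ • gram (M n) (X n) r)⁻¹ i j| ≤ C := by
  obtain ⟨K, hK0, hK⟩ := hM.exists_l2_norm_le
  obtain ⟨CX, hCX, hXb⟩ := hX.exists_abs_le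
  obtain ⟨L, hL, δ, hδ, hdet⟩ := hX.limit
  have h : ∀ i, BddLip (paramSpace c)
      (fun n ζ => nvec (matExp ζ.2 (M n) *ᵥ (X n)ᵀ i)) := fun i =>
    bddLip_regressor hK (ζ := fun ζ => ζ) (fun _ h => h) (fun _ _ => le_rfl) hCX hXb i
  choose B hB0 hB using fun i j => ((h i).real_inner (h j)).abs_apply
  refine exists_bound_inv_of_tendstoUniformlyOn hL (K := ∑ i, ∑ j, B i j)
    (fun n r hr i j => ?_) hδ hdet
  rw [smul_gram_apply]
  -- The Gram matrix depends on the second coordinate only; the first one is an arbitrary admissible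
  -- value.
  refine (hB i j n (r, r) ⟨hr, hr⟩).trans ?_
  refine (Finset.single_le_sum (f := fun j => B i j)
    (fun _ _ => hB0 _ _) (Finset.mem_univ j)).trans ?_
  exact Finset.single_le_sum (f := fun i => ∑ j, B i j)
    (fun _ _ => Finset.sum_nonneg fun _ _ => hB0 _ _) (Finset.mem_univ i)

/-- Deviations of the estimator of `β` from its population counterpart, and of the latter from the
true value. -/
theorem exists_betaOf_bounds {Ω : Type*} {Y U V : ∀ n : ℕ, Ω → Fin n → ℝ}
    (hmodel : Model W M X β₀ ζ₀ Y U V) (hW : BoundedSums W)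
    (hM : BoundedSums M) (hX : RegularRegressors M X c) (h₀ : ζ₀ ∈ paramSpace c) :
    ∃ C : ℝ, 0 ≤ C ∧ ∀ᶠ n : ℕ in atTop, ∀ ζ ∈ paramSpace c,
      (∀ ω η, 0 ≤ η → (∀ j, |regErr (W n) (M n) (X n) ζ₀ ζ (V n ω) j| ≤ η) →
        dist (betaOf (W n) (M n) (X n) (Y n ω) ζ)
          (betaOf (W n) (M n) (X n) (meanOutcome (W n) (X n) β₀ ζ₀) ζ) ≤ C * η) ∧
      dist (betaOf (W n) (M n) (X n) (meanOutcome (W n) (X n) β₀ ζ₀) ζ) β₀ ≤ C * dist ζ ζ₀ := by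
  obtain ⟨C, hC, hev⟩ := exists_bound_gram_inv hM hX
  obtain ⟨K, hK, hreg⟩ := exists_regMean_lipschitz β₀ hW hM hX h₀
  -- The summands `1` and `K` serve the stochastic deviation and the bias, respectively.
  refine ⟨k * (C * (1 + K)), by positivity, ?_⟩
  filter_upwards [hev, eventually_gt_atTop 0] with n hn hn0 ζ hζ
  obtain ⟨hdet, hb⟩ := hn ζ.2 hζ.2
  constructor
  · intro ω η hη hh
    rw [dist_eq_norm, betaOf_sub_betaOf_meanOutcome hn0 hdet (hmodel.outcome n ω)
      (hmodel.disturbance n ω)]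
    refine (pi_norm_le_iff_of_nonneg (by positivity)).2 fun i =>
      (abs_mulVec_le hb hh i).trans ?_
    rw [mul_assoc, mul_assoc]
    gcongr
    nlinarith
  · rw [dist_eq_norm, betaOf_meanOutcome_sub hn0 hdet]
    refine (pi_norm_le_iff_of_nonneg (by positivity)).2 fun i => (abs_mulVec_le (η := K * dist ζ ζ₀)
      hb (fun j => (hreg n ζ hζ (ζ₀.1, ζ.2) ⟨h₀.1, hζ.2⟩ j).trans ?_) i).trans ?_
    · refine mul_le_mul_of_nonneg_left ?_ hK
      rw [Prod.dist_eq]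
      simp only [dist_self]
      exact max_le (le_max_left _ _) dist_nonneg
    · rw [mul_assoc, mul_assoc]
      gcongr
      linarith

/-- Uniform law of large numbers for the adjusted score functions, over bounded sets of `β`. -/
theorem score_uniform_lln (hmodel : Model W M X β₀ ζ₀ Y U V) (herr : HeteroskedasticErrors μ V)
    (hW : BoundedSums W) (hM : BoundedSums M) (hX : RegularRegressors M X c)
    (h₀ : ζ₀ ∈ paramSpace c) {R : ℝ} (hR : 0 ≤ R)
    {score : ∀ n : ℕ, (Fin n → ℝ) → (Fin k → ℝ) → ℝ × ℝ → ℝ}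
    (hscore : score = (fun n => scoreLam (W n) (M n) (X n)) ∨
      score = fun n => scoreRho (W n) (M n) (X n)) :
    (∃ K : ℝ, 0 ≤ K ∧ ∀ (n : ℕ) ω, ∀ ζ ∈ paramSpace c, ∀ β ∈ Metric.closedBall 0 R,
      ∀ β' ∈ Metric.closedBall 0 R,
      |-((n : ℝ)⁻¹ * score n (Y n ω) β ζ) - -((n : ℝ)⁻¹ * score n (Y n ω) β' ζ)| ≤
        K * (1 + ‖nvec (V n ω)‖ ^ 2) * dist β β') ∧
    ∀ ε : ℝ, 0 < ε → Tendsto (fun n : ℕ => μ {ω | ∃ p ∈ Metric.closedBall 0 R ×ˢ paramSpace c,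
      ε ≤ |-((n : ℝ)⁻¹ * score n (Y n ω) p.1 p.2) -
        ∫ ω', -((n : ℝ)⁻¹ * score n (Y n ω') p.1 p.2) ∂μ|}) atTop (𝓝 0) := by
  obtain ⟨K, hKW, hKM⟩ := exists_common_l2_norm_le hW hM
  obtain ⟨CX, hCX, hXb⟩ := hX.exists_abs_le
  obtain ⟨C, hC0, hC⟩ := herr.exists_four_moment_le
  set S : Set ((Fin k → ℝ) × ℝ × ℝ) := Metric.closedBall 0 R ×ˢ paramSpace c
  have hS : TotallyBounded S :=
    ((isCompact_closedBall _ _).prod (isCompact_paramSpace c)).totallyBounded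
  have hl : ∀ p q : (Fin k → ℝ) × ℝ × ℝ, dist p.2 q.2 ≤ dist p q := fun _ _ => le_max_right _ _
  have hζ : ∀ p ∈ S, p.2 ∈ paramSpace c := fun _ h => h.2
  have bE : BddLip S (fun n p => errCoef (W n) (M n) ζ₀ p.2) := bddLip_errCoef hKW hKM hζ hl h₀
  have bR0 : BddLip S (fun n p => residMean (W n) (M n) (X n) β₀ ζ₀ 0 p.2) :=
    bddLip_residMean hKW hKM hζ hl h₀ hCX hXb β₀ (b := fun _ => 0) (R := 0) (by simp) le_rfl
      (by simp)
  have bR : BddLip S (fun n p => residMean (W n) (M n) (X n) β₀ ζ₀ p.1 p.2) :=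
    bddLip_residMean hKW hKM hζ hl h₀ hCX hXb β₀ (b := fun p => p.1) (R := R)
      (fun p hp => by simpa using hp.1) hR fun _ _ => le_max_left _ _
  have bW : BddLip S (fun n p => WD (W n) (M n) p.2.2) := bddLip_WD hKW hKM hζ hl
  have bM : BddLip S (fun n (_ : (Fin k → ℝ) × ℝ × ℝ) => M n) := BddLip.const hKM
  have main : (∃ L : ℝ, 0 ≤ L ∧ ∀ n : ℕ, ∀ p ∈ S, ∀ p' ∈ S, ∀ ω,
      |-((n : ℝ)⁻¹ * score n (Y n ω) p.1 p.2) - -((n : ℝ)⁻¹ * score n (Y n ω) p'.1 p'.2)| ≤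
        L * (1 + ‖nvec (V n ω)‖ ^ 2) * dist p p') ∧
      ∀ ε : ℝ, 0 < ε → Tendsto (fun n : ℕ => μ {ω | ∃ p ∈ S,
        ε ≤ |-((n : ℝ)⁻¹ * score n (Y n ω) p.1 p.2) -
          ∫ ω', -((n : ℝ)⁻¹ * score n (Y n ω') p.1 p.2) ∂μ|}) atTop (𝓝 0) := by
    rcases hscore with rfl | rfl
    · exact (uniform_lln_inner_affineVec hS herr.measurable herr.indep herr.mean_zero
        (fun n i => (hC n i).1) hC0 (fun n i => (hC n i).2) bR0 (bW.mulVec bR) bE (bW.mul bE)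
        (q := fun n p ω => -((n : ℝ)⁻¹ * scoreLam (W n) (M n) (X n) (Y n ω) p.1 p.2))
        fun n p ω => scoreLam_eq (hmodel.outcome n ω) (hmodel.disturbance n ω) p.1 p.2).2
    · exact (uniform_lln_inner_affineVec hS herr.measurable herr.indep herr.mean_zero
        (fun n i => (hC n i).1) hC0 (fun n i => (hC n i).2) bR (bM.mulVec bR) bE (bM.mul bE)
        (q := fun n p ω => -((n : ℝ)⁻¹ * scoreRho (W n) (M n) (X n) (Y n ω) p.1 p.2))
        fun n p ω => scoreRho_eq (hmodel.outcome n ω) (hmodel.disturbance n ω) p.1 p.2).2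
  obtain ⟨⟨L, hL0, hL⟩, hlln⟩ := main
  refine ⟨⟨L, hL0, fun n ω ζ hζ β hβ β' hβ' => ?_⟩, hlln⟩
  refine (hL n (β, ζ) ⟨hβ, hζ⟩ (β', ζ) ⟨hβ', hζ⟩ ω).trans (le_of_eq ?_)
  rw [Prod.dist_eq]
  simp

/-- Errors are bounded in probability in mean square. -/
theorem exists_measure_norm_nvec_le (herr : HeteroskedasticErrors μ V) {τ : ENNReal}
    (hτ : 0 < τ) : ∃ T : ℝ, 0 ≤ T ∧ ∀ n, μ {ω | T ≤ ‖nvec (V n ω)‖ ^ 2} ≤ τ := by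
  obtain ⟨C, hC0, hC⟩ := herr.exists_four_moment_le
  have t : Tendsto (fun T : ℝ => ENNReal.ofReal ((1 + C) / T)) atTop (𝓝 0) := by
    simpa using ENNReal.tendsto_ofReal (tendsto_id.const_div_atTop (1 + C))
  obtain ⟨T, h1, h2⟩ := ((t.eventually_lt_const hτ).and (eventually_gt_atTop 0)).exists
  refine ⟨T, h2.le, fun n => ?_⟩
  have h := integral_norm_nvec_sq_le (herr.measurable n) (fun i => (hC n i).1) hC0 fun i => (hC n i).2
  refine (measure_ge_le_ofReal_integral_div h.1 (fun ω => sq_nonneg _) h2).trans (le_trans ?_ h1.le)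
  apply ENNReal.ofReal_le_ofReal
  gcongr
  exact h.2

/-- Consistency of the M-estimator. -/
theorem tendstoInMeasure_mEstimator (hmodel : Model W M X β₀ ζ₀ Y U V)
    (herr : HeteroskedasticErrors μ V) (hW : BoundedSums W) (hM : BoundedSums M)
    (h₀ : ζ₀ ∈ paramSpace c) (hX : RegularRegressors M X c) (hid : Identified μ W M X Y ζ₀ c)
    {ζhat : ℕ → Ω → ℝ × ℝ} (hζhat : IsMEstimator μ W M X Y c ζhat) :
    TendstoInMeasure μ
      (fun n ω => (betaOf (W n) (M n) (X n) (Y n ω) (ζhat n ω), ζhat n ω))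
      atTop (fun _ => (β₀, ζ₀)) := by
  obtain ⟨C, hC, hbeta⟩ := exists_betaOf_bounds hmodel hW hM hX h₀
  obtain ⟨_, _, hC4⟩ := herr.exists_four_moment_le
  obtain ⟨Dm, hDm⟩ := (isCompact_paramSpace c).isBounded.exists_norm_le
  -- For large `n` this ball contains `β̄(ζ)` for all `ζ` in the parameter space; the extra `1`
  -- leaves room for `β̂(ζ)`.
  set R : ℝ := ‖β₀‖ + C * (|Dm| + |Dm|) + 1 with hRdef
  have hR : 0 ≤ R := by positivity
  obtain ⟨⟨K₁, hK₁, lip₁⟩, lln₁⟩ := score_uniform_lln hmodel herr hW hM hX h₀ hR (Or.inl rfl)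
  obtain ⟨⟨K₂, hK₂, lip₂⟩, lln₂⟩ := score_uniform_lln hmodel herr hW hM hX h₀ hR (Or.inr rfl)
  rw [tendstoInMeasure_iff_dist]
  intro ε hε
  rw [ENNReal.tendsto_nhds_zero]
  intro τ hτ
  have hτ2 : 0 < τ / 2 := ENNReal.half_pos hτ.ne'
  obtain ⟨T, hT0, hT⟩ := exists_measure_norm_nvec_le herr hτ2
  -- If `ζ̂` is within `ϑ` of `ζ₀`, then the bias of `β̄(ζ̂)` is less than `ε / 2`.
  set ϑ : ℝ := ε / (2 * (C + 1)) with hϑdef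
  have hϑ : 0 < ϑ := by positivity
  have hϑC : C * ϑ < ε / 2 := by
    rw [hϑdef, mul_div_assoc', div_lt_div_iff₀ (by positivity) two_pos]; nlinarith
  have hϑε : ϑ < ε := by
    rw [hϑdef, div_lt_iff₀ (by positivity)]; nlinarith
  obtain ⟨δ, hδ, hiden⟩ := hid ϑ hϑ
  -- `Q` bounds the Lipschitz constants of both scores in `β` where `‖V‖²/n < T`.
  set Q : ℝ := (K₁ + K₂) * (1 + T) with hQdef
  have hQ : 0 ≤ Q := by positivity
  -- Allowed distance of `β̂` from `β̄`: the three entries keep `β̂` in the ball, serve the final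
  -- bound, and keep the change in the scores below `δ / 2`.
  set m : ℝ := min 1 (min (ε / 2) (δ / (2 * (Q + 1)))) with hmdef
  have hm : 0 < m := by positivity
  have hQm : Q * m < δ / 2 := by
    have h1 : m ≤ δ / (2 * (Q + 1)) := (min_le_right _ _).trans (min_le_right _ _)
    have h2 : (Q + 1) * m ≤ δ / 2 := by
      rw [le_div_iff₀ (by positivity)] at h1
      linarith
    linarith
  set η : ℝ := m / (C + 1) with hηdef
  have hη : 0 < η := by positivity
  have hCη : C * η ≤ m := by
    rw [hηdef, mul_div_assoc', div_le_iff₀ (by positivity)]; nlinarith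
  have hsum : Tendsto (fun n : ℕ =>
      μ {ω | ¬ (ζhat n ω ∈ paramSpace c ∧
        concScore (W n) (M n) (X n) (Y n ω) (ζhat n ω) = 0)} +
      (∑ j, μ {ω | ∃ ζ ∈ paramSpace c, η ≤ |regErr (W n) (M n) (X n) ζ₀ ζ (V n ω) j|} +
      (μ {ω | ∃ p ∈ Metric.closedBall 0 R ×ˢ paramSpace c, δ / 2 ≤
        |-((n : ℝ)⁻¹ * scoreLam (W n) (M n) (X n) (Y n ω) p.1 p.2) -
          ∫ ω', -((n : ℝ)⁻¹ * scoreLam (W n) (M n) (X n) (Y n ω') p.1 p.2) ∂μ|} +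
      μ {ω | ∃ p ∈ Metric.closedBall 0 R ×ˢ paramSpace c, δ / 2 ≤
        |-((n : ℝ)⁻¹ * scoreRho (W n) (M n) (X n) (Y n ω) p.1 p.2) -
          ∫ ω', -((n : ℝ)⁻¹ * scoreRho (W n) (M n) (X n) (Y n ω') p.1 p.2) ∂μ|})))
      atTop (𝓝 0) := by
    have h1 : Tendsto (fun n : ℕ => ∑ j : Fin k, μ {ω | ∃ ζ ∈ paramSpace c,
        η ≤ |regErr (W n) (M n) (X n) ζ₀ ζ (V n ω) j|}) atTop (𝓝 (∑ j : Fin k, 0)) :=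
      tendsto_finsetSum _ fun j _ => tendsto_regErr herr hW hM hX h₀ j hη
    have h2 := hζhat.add (h1.add ((lln₁ _ (half_pos hδ)).add (lln₂ _ (half_pos hδ))))
    simpa using h2
  filter_upwards [hsum.eventually_lt_const hτ2, hbeta, hiden] with n hn hbn hin
  have hsub : {ω | ε ≤ dist (betaOf (W n) (M n) (X n) (Y n ω) (ζhat n ω), ζhat n ω) (β₀, ζ₀)} ⊆
      {ω | T ≤ ‖nvec (V n ω)‖ ^ 2} ∪
      ({ω | ¬ (ζhat n ω ∈ paramSpace c ∧
        concScore (W n) (M n) (X n) (Y n ω) (ζhat n ω) = 0)} ∪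
      ((⋃ j ∈ (Finset.univ : Finset (Fin k)),
        {ω | ∃ ζ ∈ paramSpace c, η ≤ |regErr (W n) (M n) (X n) ζ₀ ζ (V n ω) j|}) ∪
      ({ω | ∃ p ∈ Metric.closedBall 0 R ×ˢ paramSpace c, δ / 2 ≤
        |-((n : ℝ)⁻¹ * scoreLam (W n) (M n) (X n) (Y n ω) p.1 p.2) -
          ∫ ω', -((n : ℝ)⁻¹ * scoreLam (W n) (M n) (X n) (Y n ω') p.1 p.2) ∂μ|} ∪
      {ω | ∃ p ∈ Metric.closedBall 0 R ×ˢ paramSpace c, δ / 2 ≤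
        |-((n : ℝ)⁻¹ * scoreRho (W n) (M n) (X n) (Y n ω) p.1 p.2) -
          ∫ ω', -((n : ℝ)⁻¹ * scoreRho (W n) (M n) (X n) (Y n ω') p.1 p.2) ∂μ|}))) := by
    intro ω hω
    by_contra hcon
    simp only [Set.mem_union, Set.mem_ofPred_eq, Set.mem_iUnion, not_or, not_le, not_exists,
      not_not, Finset.mem_univ, exists_prop, true_and] at hcon
    obtain ⟨hv, ⟨hζ, hroot⟩, hreg, hl1, hl2⟩ := hcon
    set ζ := ζhat n ω with hζdef
    set bh := betaOf (W n) (M n) (X n) (Y n ω) ζ with hbh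
    set bb := betaOf (W n) (M n) (X n) (meanOutcome (W n) (X n) β₀ ζ₀) ζ with hbb
    obtain ⟨hb1, hb2⟩ := hbn ζ hζ
    have d1 : dist bh bb ≤ m := (hb1 ω η hη.le fun j => le_of_not_ge fun h => hreg j ζ ⟨hζ, h⟩).trans hCη
    have hm1 : m ≤ 1 := min_le_left _ _
    have d2 : dist ζ ζ₀ ≤ |Dm| + |Dm| := by
      rw [dist_eq_norm]
      exact (norm_sub_le _ _).trans (add_le_add ((hDm ζ hζ).trans (le_abs_self _))
        ((hDm ζ₀ h₀).trans (le_abs_self _)))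
    have d3 : dist β₀ 0 = ‖β₀‖ := dist_zero_right _
    have d4 : C * dist ζ ζ₀ ≤ C * (|Dm| + |Dm|) := mul_le_mul_of_nonneg_left d2 hC
    have mbb : bb ∈ Metric.closedBall 0 R := by
      rw [Metric.mem_closedBall]
      linarith [dist_triangle bb β₀ 0]
    have mbh : bh ∈ Metric.closedBall 0 R := by
      rw [Metric.mem_closedBall]
      linarith [dist_triangle bh bb 0, dist_triangle bb β₀ 0]
    have r1 : scoreLam (W n) (M n) (X n) (Y n ω) bh ζ = 0 := congrArg Prod.fst hroot
    have r2 : scoreRho (W n) (M n) (X n) (Y n ω) bh ζ = 0 := congrArg Prod.snd hroot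
    have p1 := lip₁ n ω ζ hζ bb mbb bh mbh
    have p2 := lip₂ n ω ζ hζ bb mbb bh mbh
    have hwt : ∀ L : ℝ, 0 ≤ L → L ≤ K₁ + K₂ →
        L * (1 + ‖nvec (V n ω)‖ ^ 2) * dist bb bh < δ / 2 := fun L hL0 hL => by
      refine lt_of_le_of_lt ?_ hQm
      rw [dist_comm, hQdef]
      gcongr
    simp only [r1, r2, mul_zero, neg_zero, sub_zero] at p1 p2
    have p1' := p1.trans_lt (hwt K₁ hK₁ (by linarith))
    have p2' := p2.trans_lt (hwt K₂ hK₂ (by linarith))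
    have q1 := not_le.1 fun h => hl1 (bb, ζ) ⟨⟨mbb, hζ⟩, h⟩
    have q2 := not_le.1 fun h => hl2 (bb, ζ) ⟨⟨mbb, hζ⟩, h⟩
    simp only at q1 q2
    -- At `β̄` each normalized sample score is within `δ / 2` of its value `0` at `β̂`, and within
    -- `δ / 2` of its mean. The population score is thus below `δ`, which identification excludes at
    -- distance `ϑ` or more. The mean is taken at fixed `(β̄(ζ), ζ)` and only then evaluated at the
    -- random `ζ`, which uniformity permits.
    have hdist : dist ζ ζ₀ < ϑ := by
      by_contra hcon
      have h := hin ζ hζ (not_lt.1 hcon)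
      rw [norm_popConcScore μ _ _ _ _ _ (integral_outcome (hmodel.outcome n) (hmodel.disturbance n)
        (integrable_of_pow_four (v := fun i ω => V n ω i) (herr.measurable n)
          fun i => (hC4 n i).1) (herr.mean_zero n))] at h
      refine absurd h (not_le.2 (max_lt ?_ ?_))
      · rw [abs_lt] at p1' q1 ⊢
        constructor <;> linarith [p1'.1, p1'.2, q1.1, q1.2]
      · rw [abs_lt] at p2' q2 ⊢
        constructor <;> linarith [p2'.1, p2'.2, q2.1, q2.2]
    have hlt : dist (bh, ζ) (β₀, ζ₀) < ε := by
      rw [Prod.dist_eq]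
      refine max_lt ?_ (hdist.trans hϑε)
      have h1 : m ≤ ε / 2 := (min_le_right _ _).trans (min_le_left _ _)
      have h2 : C * dist ζ ζ₀ ≤ C * ϑ := mul_le_mul_of_nonneg_left hdist.le hC
      simp only
      linarith [dist_triangle bh bb β₀]
    exact absurd hω (not_le.2 hlt)
  refine (measure_mono hsub).trans ?_
  rw [← ENNReal.add_halves τ]
  refine (measure_union_le _ _).trans (add_le_add (hT n) (le_trans ?_ hn.le))
  refine (measure_union_le _ _).trans (add_le_add le_rfl ?_)
  refine (measure_union_le _ _).trans (add_le_add (measure_biUnion_finset_le _ _) ?_)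
  exact measure_union_le _ _

end Consistency

end MESS

theorem theorem1 {Ω : Type*} [MeasurableSpace Ω] (μ : Measure Ω) [IsProbabilityMeasure μ]
    {k : ℕ} (W M : ∀ n : ℕ, Matrix (Fin n) (Fin n) ℝ) (X : ∀ n : ℕ, Matrix (Fin n) (Fin k) ℝ)
    (β₀ : Fin k → ℝ) (ζ₀ : ℝ × ℝ) (Y U V : ∀ n : ℕ, Ω → Fin n → ℝ) (c : ℝ)
    (hmodel : MESS.Model W M X β₀ ζ₀ Y U V)
    (herr : MESS.HeteroskedasticErrors μ V)
    (hW : MESS.BoundedSums W) (hM : MESS.BoundedSums M)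
    (hc : 0 < c) (hζ₀ : ζ₀ ∈ interior (MESS.paramSpace c))
    (hX : MESS.RegularRegressors M X c)
    (hid : MESS.Identified μ W M X Y ζ₀ c)
    (ζhat : ℕ → Ω → ℝ × ℝ) (hζhat : MESS.IsMEstimator μ W M X Y c ζhat) :
    TendstoInMeasure μ
      (fun n ω => (MESS.betaOf (W n) (M n) (X n) (Y n ω) (ζhat n ω), ζhat n ω))
      atTop (fun _ => (β₀, ζ₀)) :=
  MESS.tendstoInMeasure_mEstimator hmodel herr hW hM (interior_subset hζ₀) hX hid hζhat
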